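/- Let $N\ge 3$ and $n\ge 2$, let $\Omega\subset\mathbb R^N$ be a bounded open set, let $a_1,\dots,a_n\in\Omega$ be pairwise distinct points, and put $$V(x)=\sum_{1\le i<j\le n}\frac{|a_i-a_j|^2}{|x-a_i|^2|x-a_j|^2}.$$ Let $D^{1,2}(\Omega)$ be the completion of $C_0^\infty(\Omega)$ (smooth functions with compact support in $\Omega$) with respect to the norm $\big(\int_\Omega|\nabla u|^2\,dx\big)^{1/2}$, realised as a space of functions in $L^{2N/(N-2)}(\Omega)$ with weak gradient in $L^2(\Omega)$, let $H^1_0(\Omega)$ be the closure of $C_0^\infty(\Omega)$ in $H^1(\Omega)$, and let $$\mu^\star(\Omega)=\inf_{u\in D^{1,2}(\Omega)\setminus\{0\}}\frac{\int_\Omega|\nabla u|^2\,dx}{\int_\Omega Vu^2\,dx}.$$ Then $\int_\Omega Vu^2\,dx<\infty$ for all $u\in C_0^\infty(\Omega)$, and the following hold. (i) For every real $\mu<\frac{(N-2)^2}{4n-4}$ there is a finite constant $c_\mu\in\mathbb R$ (depending on $\Omega$ and $a_1,\dots,a_n$) such that $$c_\mu\int_\Omega u^2\,dx+\int_\Omega|\nabla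 u|^2\,dx\ \ge\ \mu\int_\Omega Vu^2\,dx\qquad\text{for all }u\in C_0^\infty(\Omega).$$ (ii) For every $\mu>\frac{(N-2)^2}{4n-4}$ and every $\lambda\in\mathbb R$ there is $u_{\lambda,\mu}\in C_0^\infty(\Omega)$ such that $$\lambda\int_\Omega u_{\lambda,\mu}^2\,dx+\int_\Omega|\nabla u_{\lambda,\mu}|^2\,dx\ <\ \mu\int_\Omega Vu_{\lambda,\mu}^2\,dx.$$ Consequently the weak Hardy constant, that is, the supremum of all $\mu>0$ for which there is $c\in\mathbb R$ with $\int_\Omega|\nabla u|^2\,dx-\mu\int_\Omega Vu^2\,dx\ge c\int_\Omega u^2\,dx$ for all $u\in C_0^\infty(\Omega)$, equals $\frac{(N-2)^2}{4n-4}$. (iii) If $\mu^\star(\Omega)<\frac{(N-2)^2}{4n-4}$, then $\mu^\star(\Omega)$ is attained in $H^1_0(\Omega)$: there is $u\in H^1_0(\Omega)\setminus\{0\}$ with $\int_\Omega|\nabla u|^2\,dx\big/\int_\Omega Vu^2\,dx=\mu^\star(\Omega)$. (iv) If $n=2$, then $\mu^\star(\Omega)$ is not attained by any $u\in D^{1,2}(\Omega)\setminus\{0\}$.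 -/

import Mathlib

open MeasureTheory Filter Topology TopologicalSpace
open scoped ENNReal Distributions Gradient

namespace MultipolarHardy

noncomputable section

/-- The potential `V(x) = ∑_{i<j} |a_i - a_j|² / (|x - a_i|² |x - a_j|²)` with poles `a_1, …, a_n`.
(Its value at the poles themselves, a null set, is irrelevant.) -/
def potential {N n : ℕ} (a : Fin n → EuclideanSpace ℝ (Fin N)) (x : EuclideanSpace ℝ (Fin N)) : ℝ :=
  ∑ i, ∑ j ∈ Finset.Ioi i, ‖a i - a j‖ ^ 2 / (‖x - a i‖ ^ 2 * ‖x - a j‖ ^ 2)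

/-- `u ∈ L^p(Ω)` and `g ∈ L²(Ω; ℝ^N)` are the limits, in `L^p(Ω)` and `L²(Ω; ℝ^N)` respectively, of
`φ_k` and of `∇φ_k` for one sequence `φ_k ∈ C_0^∞(Ω)`. Then `g` is the weak gradient of `u`.
Only the values of `u` and `g` on `Ω` matter. -/
structure MemClosure {N : ℕ} (p : ℝ≥0∞) (Ω : Opens (EuclideanSpace ℝ (Fin N)))
    (u : EuclideanSpace ℝ (Fin N) → ℝ)
    (g : EuclideanSpace ℝ (Fin N) → EuclideanSpace ℝ (Fin N)) : Prop where
  memLp : MemLp u p (volume.restrict (Ω : Set (EuclideanSpace ℝ (Fin N))))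
  memLp_grad : MemLp g 2 (volume.restrict (Ω : Set (EuclideanSpace ℝ (Fin N))))
  approx : ∃ φ : ℕ → 𝓓(Ω, ℝ),
    Tendsto (fun k => eLpNorm (fun x => φ k x - u x) p
      (volume.restrict (Ω : Set (EuclideanSpace ℝ (Fin N))))) atTop (𝓝 0) ∧
    Tendsto (fun k => eLpNorm (fun x => ∇ (φ k : EuclideanSpace ℝ (Fin N) → ℝ) x - g x) 2
      (volume.restrict (Ω : Set (EuclideanSpace ℝ (Fin N))))) atTop (𝓝 0)

/-- `u ∈ H¹₀(Ω)`, with weak gradient `g`: the closure of `C_0^∞(Ω)` in the `H¹(Ω)` norm. -/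
def MemH10 {N : ℕ} (Ω : Opens (EuclideanSpace ℝ (Fin N)))
    (u : EuclideanSpace ℝ (Fin N) → ℝ)
    (g : EuclideanSpace ℝ (Fin N) → EuclideanSpace ℝ (Fin N)) : Prop :=
  MemClosure 2 Ω u g

/-- `u ∈ D^{1,2}(Ω)`, with weak gradient `g`, in dimension `N ≥ 3`: the completion of `C_0^∞(Ω)`
with respect to the `L²` norm of the gradient. By the Sobolev inequality a sequence of test
functions that is Cauchy for this norm converges in `L^{2N/(N-2)}`, and the completion is realised
as the space of these limits. -/
def MemD12 {N : ℕ} (Ω : Opens (EuclideanSpace ℝ (Fin N)))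
    (u : EuclideanSpace ℝ (Fin N) → ℝ)
    (g : EuclideanSpace ℝ (Fin N) → EuclideanSpace ℝ (Fin N)) : Prop :=
  MemClosure (ENNReal.ofReal (2 * N / (N - 2))) Ω u g

/-- The quotient `∫_Ω |g|² / ∫_Ω V u²`, the integrals being those of nonnegative functions. -/
def hardyQuotient {N n : ℕ} (a : Fin n → EuclideanSpace ℝ (Fin N))
    (Ω : Opens (EuclideanSpace ℝ (Fin N))) (u : EuclideanSpace ℝ (Fin N) → ℝ)
    (g : EuclideanSpace ℝ (Fin N) → EuclideanSpace ℝ (Fin N)) : ℝ≥0∞ :=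
  (∫⁻ x in Ω, ENNReal.ofReal (‖g x‖ ^ 2)) / ∫⁻ x in Ω, ENNReal.ofReal (potential a x * u x ^ 2)

/-- The optimal constant `μ*(Ω)`: the infimum of `∫_Ω |∇u|² / ∫_Ω V u²` over the nonzero
`u ∈ D^{1,2}(Ω)`. -/
def hardyConstant {N n : ℕ} (a : Fin n → EuclideanSpace ℝ (Fin N))
    (Ω : Opens (EuclideanSpace ℝ (Fin N))) : ℝ≥0∞ :=
  sInf {q | ∃ u g, MemD12 Ω u g ∧
    ¬ u =ᵐ[volume.restrict (Ω : Set (EuclideanSpace ℝ (Fin N)))] 0 ∧ q = hardyQuotient a Ω u g}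

/-- The parameters `μ > 0` for which `-Δ - μ V` is bounded below on `C_0^∞(Ω)`. The weak Hardy
constant is the supremum of this set. -/
def weakHardyParameters {N n : ℕ} (a : Fin n → EuclideanSpace ℝ (Fin N))
    (Ω : Opens (EuclideanSpace ℝ (Fin N))) : Set ℝ :=
  {μ | 0 < μ ∧ ∃ c : ℝ, ∀ u : 𝓓(Ω, ℝ),
    (∫ x in Ω, ‖∇ (u : EuclideanSpace ℝ (Fin N) → ℝ) x‖ ^ 2)
      - μ * ∫ x in Ω, potential a x * u x ^ 2 ≥ c * ∫ x in Ω, u x ^ 2}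

end

end MultipolarHardy

/-!
If a vector field `F` has weak divergence `D`, expanding `0 ≤ ∫ ‖∇u + u F‖²` gives
`∫ (D - ‖F‖²) u² ≤ ∫ ‖∇u‖²`. Let `Y` be the sum of the fields `(x - aᵢ) / ‖x - aᵢ‖²` and `S` the sum
of the `‖x - aᵢ‖⁻²`, so that `div Y = (N - 2) S` and `V = n S - ‖Y‖²`. Up to a bounded error only
one summand of `Y` is large at a time, hence `‖Y‖² ≤ (1 + δ) S + C`, and a suitable multiple of `Y`
gives the lower bound up to a multiple of `∫ u²`. The constant is optimal because
`V ~ (n - 1) / ‖x - aᵢ‖²` at a pole, where the virtual ground state `‖x - aᵢ‖^(-(N - 2) / 2)` of the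
Hardy inequality can be cut off.

Below the threshold, a minimizing sequence normalised by `∫ V u² = 1` is bounded in `H¹`, so it has
an `L²`-convergent subsequence by Rellich; the weak inequality and the parallelogram law for the
form `∫ ‖∇u‖² - μ⋆ ∫ V u²` then make its gradients Cauchy. For two poles, adding to a multiple of
`Y` a small field in a direction orthogonal to `a₀ - a₁` makes the inequality at the threshold
strict on the bounded set `Ω`, so that no minimizer exists.
-/

namespace MultipolarHardy

noncomputable section

lemma hasCompactSupport_sq {X : Type*} [TopologicalSpace X] {u : X → ℝ}
    (hu : HasCompactSupport u) : HasCompactSupport fun x => u x ^ 2 :=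
  hu.comp_left (g := fun y : ℝ => y ^ 2) (zero_pow two_ne_zero)

section Gradient

variable {E : Type*} [NormedAddCommGroup E] [InnerProductSpace ℝ E] [CompleteSpace E] {u : E → ℝ}

lemma continuous_gradient (hu : ContDiff ℝ 1 u) : Continuous (∇ u) :=
  (InnerProductSpace.toDual ℝ E).symm.continuous.comp (hu.continuous_fderiv one_ne_zero)

lemma hasCompactSupport_gradient (hu : HasCompactSupport u) : HasCompactSupport (∇ u) :=
  (hu.fderiv ℝ).comp_left (g := (InnerProductSpace.toDual ℝ E).symm) (map_zero _)

lemma gradient_sq_apply {x : E} (hu : DifferentiableAt ℝ u x) :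
    ∇ (fun y => u y ^ 2) x = (2 * u x) • ∇ u x := by
  rw [gradient, (hu.hasFDerivAt.pow 2).fderiv]
  simp [gradient, two_smul, two_mul, add_smul]

lemma integrable_norm_gradient_sq [MeasurableSpace E] [BorelSpace E] {μ : Measure E}
    [IsFiniteMeasureOnCompacts μ] (hu : ContDiff ℝ 1 u) (hu' : HasCompactSupport u) :
    Integrable (fun x => ‖∇ u x‖ ^ 2) μ :=
  Continuous.integrable_of_hasCompactSupport ((continuous_gradient hu).norm.pow 2)
    ((hasCompactSupport_gradient hu').comp_left (g := fun y => ‖y‖ ^ 2) (by simp))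

end Gradient

section WeakDivergence

variable {E : Type*} [NormedAddCommGroup E] [InnerProductSpace ℝ E] [FiniteDimensional ℝ E]
  [MeasurableSpace E] [BorelSpace E]

/-- `D` is the divergence of the vector field `F` in the sense of distributions. Local square
integrability of `F` is part of the notion, so that `D - ‖F‖ ^ 2` can be tested against squares. -/
structure HasWeakDivergence (F : E → E) (D : E → ℝ) : Prop where
  aestronglyMeasurable : AEStronglyMeasurable F
  locallyIntegrable_norm_sq : LocallyIntegrable fun x => ‖F x‖ ^ 2
  locallyIntegrable_div : LocallyIntegrable D
  integral_mul : ∀ v : E → ℝ, ContDiff ℝ 1 v → HasCompactSupport v →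
    ∫ x, D x * v x = -∫ x, inner ℝ (∇ v x) (F x)

variable {F G : E → E} {D D' : E → ℝ} {u : E → ℝ}

lemma HasWeakDivergence.integrable_div_mul (h : HasWeakDivergence F D) (hu : Continuous u)
    (hu' : HasCompactSupport u) : Integrable fun x => D x * u x :=
  h.locallyIntegrable_div.integrable_smul_right_of_hasCompactSupport hu hu'

lemma HasWeakDivergence.integrable_inner (h : HasWeakDivergence F D) {w : E → E}
    (hw : Continuous w) (hw' : HasCompactSupport w) :
    Integrable fun x => inner ℝ (w x) (F x) := by
  have hnorm : Integrable fun x => (‖F x‖ ^ 2 + 1) * ‖w x‖ :=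
    (h.locallyIntegrable_norm_sq.add (locallyIntegrable_const 1))
      |>.integrable_smul_right_of_hasCompactSupport hw.norm hw'.norm
  refine hnorm.mono' (hw.aestronglyMeasurable.inner h.aestronglyMeasurable)
    (Eventually.of_forall fun x => ?_)
  calc ‖inner ℝ (w x) (F x)‖ ≤ ‖w x‖ * ‖F x‖ := norm_inner_le_norm _ _
    _ ≤ (‖F x‖ ^ 2 + 1) * ‖w x‖ := by
      nlinarith [norm_nonneg (w x), sq_nonneg (‖F x‖ - 1), norm_nonneg (F x)]

lemma HasWeakDivergence.zero : HasWeakDivergence (0 : E → E) 0 where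
  aestronglyMeasurable := aestronglyMeasurable_zero
  locallyIntegrable_norm_sq := by simpa using locallyIntegrable_zero
  locallyIntegrable_div := locallyIntegrable_zero
  integral_mul := by simp

lemma HasWeakDivergence.add (hF : HasWeakDivergence F D) (hG : HasWeakDivergence G D') :
    HasWeakDivergence (F + G) (D + D') where
  aestronglyMeasurable := hF.aestronglyMeasurable.add hG.aestronglyMeasurable
  locallyIntegrable_norm_sq := by
    refine ((hF.locallyIntegrable_norm_sq.add hG.locallyIntegrable_norm_sq).smul (2 : ℝ)).mono
      ((hF.aestronglyMeasurable.add hG.aestronglyMeasurable).norm.pow 2)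
      (Eventually.of_forall fun x => ?_)
    refine (Real.norm_of_nonneg (sq_nonneg _)).trans_le (le_trans ?_ (Real.le_norm_self _))
    calc ‖(F + G) x‖ ^ 2 ≤ (‖F x‖ + ‖G x‖) ^ 2 := by gcongr; exact norm_add_le _ _
      _ ≤ 2 * (‖F x‖ ^ 2 + ‖G x‖ ^ 2) := add_sq_le
  locallyIntegrable_div := hF.locallyIntegrable_div.add hG.locallyIntegrable_div
  integral_mul v hv hv' := by
    have hg := continuous_gradient hv
    have hg' := hasCompactSupport_gradient hv'
    simp only [Pi.add_apply, add_mul, inner_add_right]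
    rw [integral_add (hF.integrable_div_mul hv.continuous hv')
      (hG.integrable_div_mul hv.continuous hv'), integral_add (hF.integrable_inner hg hg')
      (hG.integrable_inner hg hg'), hF.integral_mul v hv hv', hG.integral_mul v hv hv', neg_add]

lemma HasWeakDivergence.const_smul (c : ℝ) (hF : HasWeakDivergence F D) :
    HasWeakDivergence (c • F) (c • D) where
  aestronglyMeasurable := hF.aestronglyMeasurable.const_smul c
  locallyIntegrable_norm_sq := by
    simp only [Pi.smul_apply, norm_smul, mul_pow]
    exact hF.locallyIntegrable_norm_sq.smul (‖c‖ ^ 2)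
  locallyIntegrable_div := hF.locallyIntegrable_div.smul c
  integral_mul v hv hv' := by
    simp only [Pi.smul_apply, smul_eq_mul, mul_assoc, inner_smul_right, integral_const_mul,
      hF.integral_mul v hv hv', mul_neg]

lemma HasWeakDivergence.sum {ι : Type*} (s : Finset ι) {F : ι → E → E} {D : ι → E → ℝ}
    (h : ∀ i ∈ s, HasWeakDivergence (F i) (D i)) :
    HasWeakDivergence (∑ i ∈ s, F i) (∑ i ∈ s, D i) := by
  classical
  induction s using Finset.induction_on with
  | empty => exact .zero
  | insert i s hi ih =>
    rw [Finset.sum_insert hi, Finset.sum_insert hi]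
    exact (h i (s.mem_insert_self i)).add (ih fun j hj => h j (Finset.mem_insert_of_mem hj))

lemma integrable_mul_fderiv_apply {v f : E → ℝ} (hv : Continuous v) (hv' : HasCompactSupport v)
    (hf : ContDiff ℝ 1 f) (e : E) : Integrable fun x => v x * fderiv ℝ f x e :=
  (hv.mul ((hf.continuous_fderiv one_ne_zero).clm_apply continuous_const))
    |>.integrable_of_hasCompactSupport hv'.mul_right

lemma integrable_fderiv_apply_mul {v f : E → ℝ} (hv : ContDiff ℝ 1 v) (hv' : HasCompactSupport v)
    (hf : Continuous f) (e : E) : Integrable fun x => fderiv ℝ v x e * f x :=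
  (((hv.continuous_fderiv one_ne_zero).clm_apply continuous_const).mul hf)
    |>.integrable_of_hasCompactSupport
      (((hv'.fderiv ℝ).comp_left (g := fun L : E →L[ℝ] ℝ => L e) rfl).mul_right)

lemma integral_mul_fderiv_apply_eq_neg {v f : E → ℝ} (hv : ContDiff ℝ 1 v)
    (hv' : HasCompactSupport v) (hf : ContDiff ℝ 1 f) (e : E) :
    ∫ x, v x * fderiv ℝ f x e = -∫ x, fderiv ℝ v x e * f x :=
  integral_mul_fderiv_eq_neg_fderiv_mul_of_integrable
    (integrable_fderiv_apply_mul hv hv' hf.continuous e)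
    (integrable_mul_fderiv_apply hv.continuous hv' hf e)
    ((hv.continuous.mul hf.continuous).integrable_of_hasCompactSupport hv'.mul_right)
    (fun x _ => hv.differentiable one_ne_zero x) (fun x _ => hf.differentiable one_ne_zero x)

lemma HasWeakDivergence.of_contDiff (hF : ContDiff ℝ 1 F) :
    HasWeakDivergence F fun x => LinearMap.trace ℝ E (fderiv ℝ F x) where
  aestronglyMeasurable := hF.continuous.aestronglyMeasurable
  locallyIntegrable_norm_sq := (hF.continuous.norm.pow 2).locallyIntegrable
  locallyIntegrable_div := by
    refine Continuous.locallyIntegrable ?_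
    exact (LinearMap.trace ℝ E ∘ₗ ContinuousLinearMap.coeLM ℝ).continuous_of_finiteDimensional.comp
      (hF.continuous_fderiv one_ne_zero)
  integral_mul v hv hv' := by
    set b := stdOrthonormalBasis ℝ E
    have hcoord (i) : ContDiff ℝ 1 fun x => inner ℝ (b i) (F x) := contDiff_const.inner ℝ hF
    have hcoord_fderiv (i x) :
        fderiv ℝ (fun x => inner ℝ (b i) (F x)) x (b i) = inner ℝ (b i) (fderiv ℝ F x (b i)) := by
      rw [fderiv_inner_apply ℝ (differentiableAt_const _) (hF.differentiable one_ne_zero x)]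
      simp
    have hdiv (x) : LinearMap.trace ℝ E (fderiv ℝ F x) * v x =
        ∑ i, v x * fderiv ℝ (fun x => inner ℝ (b i) (F x)) x (b i) := by
      rw [LinearMap.trace_eq_sum_inner _ b, Finset.sum_mul]
      exact Finset.sum_congr rfl fun i _ => by rw [hcoord_fderiv, mul_comm]; rfl
    have hinner (x) : inner ℝ (∇ v x) (F x) =
        ∑ i, fderiv ℝ v x (b i) * inner ℝ (b i) (F x) := by
      rw [← b.sum_inner_mul_inner]
      simp only [inner_gradient_left]
    simp_rw [hdiv, hinner]
    rw [integral_finsetSum _ fun i _ =>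
        integrable_mul_fderiv_apply hv.continuous hv' (hcoord i) (b i),
      integral_finsetSum _ fun i _ =>
        integrable_fderiv_apply_mul hv hv' (hcoord i).continuous (b i), ← Finset.sum_neg_distrib]
    exact Finset.sum_congr rfl fun i _ => integral_mul_fderiv_apply_eq_neg hv hv' (hcoord i) (b i)

lemma HasWeakDivergence.of_tendsto {Fs : ℕ → E → E} {Ds : ℕ → E → ℝ} {B : E → ℝ}
    (h : ∀ k, HasWeakDivergence (Fs k) (Ds k)) (hB : LocallyIntegrable B)
    (hFB : ∀ k, ∀ᵐ x, ‖Fs k x‖ ^ 2 ≤ B x) (hDB : ∀ k, ∀ᵐ x, ‖Ds k x‖ ≤ B x)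
    (hF : ∀ᵐ x, Tendsto (Fs · x) atTop (𝓝 (F x))) (hD : ∀ᵐ x, Tendsto (Ds · x) atTop (𝓝 (D x))) :
    HasWeakDivergence F D := by
  have hFm : AEStronglyMeasurable F :=
    aestronglyMeasurable_of_tendsto_ae atTop (fun k => (h k).aestronglyMeasurable) hF
  have hDm : AEStronglyMeasurable D :=
    aestronglyMeasurable_of_tendsto_ae atTop
      (fun k => (h k).locallyIntegrable_div.aestronglyMeasurable) hD
  refine ⟨hFm, hB.mono (hFm.norm.pow 2) ?_, hB.mono hDm ?_, fun v hv hv' => ?_⟩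
  · filter_upwards [ae_all_iff.2 hFB, hF] with x hx hFx
    rw [Real.norm_of_nonneg (by positivity)]
    exact (le_of_tendsto' (hFx.norm.pow 2) hx).trans (Real.le_norm_self _)
  · filter_upwards [ae_all_iff.2 hDB, hD] with x hx hDx
    exact (le_of_tendsto' hDx.norm hx).trans (Real.le_norm_self _)
  have hvg := continuous_gradient hv
  have hvg' := hasCompactSupport_gradient hv'
  have hlim_div : Tendsto (fun k => ∫ x, Ds k x * v x) atTop (𝓝 (∫ x, D x * v x)) := by
    refine tendsto_integral_of_dominated_convergence (fun x => B x * ‖v x‖)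
      (fun k => ((h k).integrable_div_mul hv.continuous hv').aestronglyMeasurable)
      (hB.integrable_smul_right_of_hasCompactSupport hv.continuous.norm hv'.norm) (fun k => ?_) ?_
    · filter_upwards [hDB k] with x hx
      rw [norm_mul]
      gcongr
    · filter_upwards [hD] with x hx using hx.mul_const _
  have hlim_inner : Tendsto (fun k => ∫ x, inner ℝ (∇ v x) (Fs k x)) atTop
      (𝓝 (∫ x, inner ℝ (∇ v x) (F x))) := by
    refine tendsto_integral_of_dominated_convergence (fun x => (B x + 1) * ‖∇ v x‖)
      (fun k => ((h k).integrable_inner hvg hvg').aestronglyMeasurable)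
      ((hB.add (locallyIntegrable_const 1)).integrable_smul_right_of_hasCompactSupport hvg.norm
        hvg'.norm) (fun k => ?_) ?_
    · filter_upwards [hFB k] with x hx
      calc ‖inner ℝ (∇ v x) (Fs k x)‖ ≤ ‖∇ v x‖ * ‖Fs k x‖ := norm_inner_le_norm _ _
        _ ≤ ‖∇ v x‖ * (B x + 1) := by
          gcongr
          nlinarith [sq_nonneg (‖Fs k x‖ - 1), sq_nonneg ‖Fs k x‖]
        _ = _ := mul_comm _ _
    · filter_upwards [hF] with x hx using tendsto_const_nhds.inner hx
  simp_rw [fun k => (h k).integral_mul v hv hv'] at hlim_div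
  exact tendsto_nhds_unique hlim_div hlim_inner.neg

lemma HasWeakDivergence.integrable_div_sub_norm_sq_mul (h : HasWeakDivergence F D)
    (hu : Continuous u) (hu' : HasCompactSupport u) :
    Integrable fun x => (D x - ‖F x‖ ^ 2) * u x :=
  (h.locallyIntegrable_div.sub h.locallyIntegrable_norm_sq)
    |>.integrable_smul_right_of_hasCompactSupport hu hu'

-- This is `0 ≤ ∫ ‖∇ u + u • F‖ ^ 2`, the mixed term being integrated by parts.
lemma HasWeakDivergence.integral_div_sub_norm_sq_mul_sq_le (h : HasWeakDivergence F D)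
    (hu : ContDiff ℝ 1 u) (hu' : HasCompactSupport u) :
    ∫ x, (D x - ‖F x‖ ^ 2) * u x ^ 2 ≤ ∫ x, ‖∇ u x‖ ^ 2 := by
  have hsq : ContDiff ℝ 1 fun x => u x ^ 2 := hu.pow 2
  have hsq' : HasCompactSupport fun x => u x ^ 2 := hasCompactSupport_sq hu'
  have hgrad := integrable_norm_gradient_sq (μ := volume) hu hu'
  have hmixed := h.integrable_inner (continuous_gradient hsq) (hasCompactSupport_gradient hsq')
  have hfield : Integrable fun x => ‖F x‖ ^ 2 * u x ^ 2 :=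
    h.locallyIntegrable_norm_sq.integrable_smul_right_of_hasCompactSupport hsq.continuous hsq'
  have hexpand (x) : ‖∇ u x + u x • F x‖ ^ 2 =
      ‖∇ u x‖ ^ 2 + inner ℝ (∇ (fun x => u x ^ 2) x) (F x) + ‖F x‖ ^ 2 * u x ^ 2 := by
    rw [norm_add_sq_real, gradient_sq_apply (hu.differentiable one_ne_zero x), inner_smul_right,
      inner_smul_left, norm_smul, mul_pow, Real.norm_eq_abs, sq_abs, conj_trivial]
    ring
  have hnonneg : 0 ≤ ∫ x, ‖∇ u x + u x • F x‖ ^ 2 := integral_nonneg fun x => by positivity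
  simp_rw [hexpand] at hnonneg
  rw [integral_add (by exact hgrad.add hmixed) hfield, integral_add hgrad hmixed] at hnonneg
  simp_rw [sub_mul]
  rw [integral_sub (h.integrable_div_mul hsq.continuous hsq') hfield, h.integral_mul _ hsq hsq']
  linarith

end WeakDivergence

section PoleField

variable {E : Type*} [NormedAddCommGroup E] [InnerProductSpace ℝ E]

/-- The field `(x - a) / |x - a|²`, whose combinations are the vector fields behind the multipolar
Hardy inequalities. It takes the value `0` at its pole. -/
def poleField (a x : E) : E := (‖x - a‖ ^ 2)⁻¹ • (x - a)

lemma norm_poleField (a x : E) : ‖poleField a x‖ = ‖x - a‖⁻¹ := by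
  rw [poleField, norm_smul, norm_inv, norm_pow, norm_norm, ← div_eq_inv_mul, sq,
    div_self_mul_self']

lemma norm_poleField_sq (a x : E) : ‖poleField a x‖ ^ 2 = (‖x - a‖ ^ 2)⁻¹ := by
  rw [norm_poleField, inv_pow]

lemma norm_poleField_sub_sq {a b x : E} (ha : x ≠ a) (hb : x ≠ b) :
    ‖poleField a x - poleField b x‖ ^ 2 = ‖a - b‖ ^ 2 / (‖x - a‖ ^ 2 * ‖x - b‖ ^ 2) := by
  have h := dist_div_norm_sq_smul (sub_ne_zero.2 ha) (sub_ne_zero.2 hb) 1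
  simp only [one_div, one_pow, inv_pow, dist_eq_norm, sub_sub_sub_cancel_left] at h
  rw [poleField, poleField, h, norm_sub_rev b a]
  ring

variable [FiniteDimensional ℝ E] [MeasurableSpace E] [BorelSpace E]

lemma locallyIntegrable_inv_norm_sub_sq (hE : 2 < Module.finrank ℝ E) (a : E) :
    LocallyIntegrable fun x : E => (‖x - a‖ ^ 2)⁻¹ := by
  have hcentred : LocallyIntegrable fun x : E => (‖x‖ ^ 2)⁻¹ := by
    refine locallyIntegrable_of_norm_le_rpow (C := 1) (α := 2) (by omega) (by exact_mod_cast hE)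
      (Eventually.of_forall fun x => ?_) (by fun_prop : Measurable _).aestronglyMeasurable
    rw [one_mul, Real.rpow_neg (norm_nonneg _)]
    simp
  refine (locallyIntegrable_map_homeomorph (Homeomorph.subRight a) (f := fun x => (‖x‖ ^ 2)⁻¹)).1 ?_
  rwa [Homeomorph.coe_subRight, map_sub_right_eq_self]

lemma hasWeakDivergence_smul_const {f : E → ℝ} (hf : ContDiff ℝ 1 f) (e : E) :
    HasWeakDivergence (fun x => f x • e) fun x => fderiv ℝ f x e := by
  convert HasWeakDivergence.of_contDiff (F := fun x => f x • e) (hf.smul contDiff_const) using 2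
    with x
  rw [fderiv_smul_const (hf.differentiable one_ne_zero x)]
  exact (LinearMap.trace_smulRight (fderiv ℝ f x).toLinearMap e).symm

lemma hasWeakDivergence_smul_sub {f : E → ℝ} (hf : ContDiff ℝ 1 f) (a : E) :
    HasWeakDivergence (fun x => f x • (x - a))
      fun x => f x * Module.finrank ℝ E + fderiv ℝ f x (x - a) := by
  convert HasWeakDivergence.of_contDiff (F := fun x => f x • (x - a))
    (hf.smul (contDiff_id.sub contDiff_const)) using 2 with x
  have hderiv : (fderiv ℝ (fun x => f x • (x - a)) x : E →ₗ[ℝ] E) =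
      f x • LinearMap.id + (fderiv ℝ f x).toLinearMap.smulRight (x - a) := by
    rw [fderiv_fun_smul (hf.differentiable one_ne_zero x) (by fun_prop)]
    ext y
    simp [fderiv_sub_const]
  rw [hderiv, map_add, map_smul, LinearMap.trace_id, LinearMap.trace_smulRight]
  rfl

lemma hasWeakDivergence_inner_pow_smul (e p : E) (k : ℕ) :
    HasWeakDivergence (fun x => inner ℝ e (x - p) ^ (k + 1) • e)
      fun x => (k + 1) * inner ℝ e (x - p) ^ k * ‖e‖ ^ 2 := by
  have hf : ContDiff ℝ 1 fun x => inner ℝ e (x - p) ^ (k + 1) :=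
    (contDiff_const.inner ℝ (contDiff_id.sub contDiff_const)).pow _
  convert hasWeakDivergence_smul_const hf e using 2 with x
  have hinner : HasFDerivAt (fun x => inner ℝ e (x - p)) (innerSL ℝ e) x :=
    (innerSL ℝ e).hasFDerivAt.comp x ((hasFDerivAt_id x).sub_const p)
  rw [(hinner.pow (k + 1)).fderiv]
  simp

lemma hasWeakDivergence_regularized_poleField (a : E) {ε : ℝ} (hε : 0 < ε) :
    HasWeakDivergence (fun x => (‖x - a‖ ^ 2 + ε)⁻¹ • (x - a)) fun x =>
      (‖x - a‖ ^ 2 + ε)⁻¹ * Module.finrank ℝ E - 2 * ‖x - a‖ ^ 2 * ((‖x - a‖ ^ 2 + ε)⁻¹) ^ 2 := by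
  have hpos (x : E) : ‖x - a‖ ^ 2 + ε ≠ 0 := by positivity
  have hf : ContDiff ℝ 1 fun x : E => (‖x - a‖ ^ 2 + ε)⁻¹ :=
    (((contDiff_id.sub contDiff_const).norm_sq ℝ).add contDiff_const).inv hpos
  convert hasWeakDivergence_smul_sub hf a using 2 with x
  have hsq : HasFDerivAt (fun x : E => ‖x - a‖ ^ 2 + ε) (2 • innerSL ℝ (x - a)) x := by
    simpa using ((hasFDerivAt_id x).sub_const a).norm_sq.add_const ε
  have hinv : HasFDerivAt (fun x : E => (‖x - a‖ ^ 2 + ε)⁻¹)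
      (-((‖x - a‖ ^ 2 + ε) ^ 2)⁻¹ • (2 • innerSL ℝ (x - a))) x :=
    (hasDerivAt_inv (hpos x)).comp_hasFDerivAt x hsq
  rw [sub_eq_add_neg, hinv.fderiv]
  simp only [inv_pow, neg_smul, neg_apply, smul_apply, coe_innerSL_apply,
    inner_self_eq_norm_sq_to_K, Real.ringHom_apply, nsmul_eq_mul, Nat.cast_ofNat, smul_eq_mul,
    add_right_inj, neg_inj]
  ring

lemma hasWeakDivergence_poleField (hE : 2 < Module.finrank ℝ E) (a : E) :
    HasWeakDivergence (poleField a) fun x => (Module.finrank ℝ E - 2) * (‖x - a‖ ^ 2)⁻¹ := by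
  have : Nontrivial E := Module.nontrivial_of_finrank_pos (R := ℝ) (by omega)
  set d : ℝ := (Module.finrank ℝ E : ℝ)
  have hne : ∀ᵐ x : E, x ≠ a := Measure.ae_ne volume a
  have hle (k : ℕ) (x : E) : ‖x - a‖ ^ 2 ≤ ‖x - a‖ ^ 2 + 1 / ((k : ℝ) + 1) :=
    le_add_of_nonneg_right (by positivity)
  have hlim {x : E} (hx : x ≠ a) :
      Tendsto (fun k : ℕ => (‖x - a‖ ^ 2 + 1 / ((k : ℝ) + 1))⁻¹) atTop (𝓝 (‖x - a‖ ^ 2)⁻¹) := by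
    have h := tendsto_one_div_add_atTop_nhds_zero_nat.const_add (‖x - a‖ ^ 2)
    rw [add_zero] at h
    exact h.inv₀ (by simpa [sub_eq_zero] using hx)
  refine .of_tendsto (fun k : ℕ => hasWeakDivergence_regularized_poleField a
      (ε := 1 / ((k : ℝ) + 1)) (by positivity))
    ((locallyIntegrable_inv_norm_sub_sq hE a).smul (d + 2)) (fun k => ?_) (fun k => ?_) ?_ ?_
  · filter_upwards [hne] with x hx
    have hpos := norm_pos_iff.2 (sub_ne_zero.2 hx)
    calc ‖(‖x - a‖ ^ 2 + 1 / ((k : ℝ) + 1))⁻¹ • (x - a)‖ ^ 2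
        = ((‖x - a‖ ^ 2 + 1 / ((k : ℝ) + 1))⁻¹) ^ 2 * ‖x - a‖ ^ 2 := by
          rw [norm_smul, mul_pow, Real.norm_eq_abs, sq_abs]
      _ ≤ ((‖x - a‖ ^ 2)⁻¹) ^ 2 * ‖x - a‖ ^ 2 := by gcongr; exact hle k x
      _ = 1 * (‖x - a‖ ^ 2)⁻¹ := by field_simp
      _ ≤ (d + 2) * (‖x - a‖ ^ 2)⁻¹ := by
          gcongr
          linarith [show (0 : ℝ) ≤ d from Nat.cast_nonneg _]
  · filter_upwards [hne] with x hx
    have hpos := norm_pos_iff.2 (sub_ne_zero.2 hx)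
    have hd : 0 ≤ d := Nat.cast_nonneg _
    calc _ ≤ ‖(‖x - a‖ ^ 2 + 1 / ((k : ℝ) + 1))⁻¹ * d‖ +
          ‖2 * ‖x - a‖ ^ 2 * ((‖x - a‖ ^ 2 + 1 / ((k : ℝ) + 1))⁻¹) ^ 2‖ := norm_sub_le _ _
      _ = (‖x - a‖ ^ 2 + 1 / ((k : ℝ) + 1))⁻¹ * d +
          2 * ‖x - a‖ ^ 2 * ((‖x - a‖ ^ 2 + 1 / ((k : ℝ) + 1))⁻¹) ^ 2 := by
          rw [Real.norm_of_nonneg (by positivity), Real.norm_of_nonneg (by positivity)]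
      _ ≤ (‖x - a‖ ^ 2)⁻¹ * d + 2 * ‖x - a‖ ^ 2 * ((‖x - a‖ ^ 2)⁻¹) ^ 2 := by
          gcongr <;> exact hle k x
      _ = (d + 2) * (‖x - a‖ ^ 2)⁻¹ := by field_simp
  · filter_upwards [hne] with x hx using (hlim hx).smul_const _
  · filter_upwards [hne] with x hx
    have h := ((hlim hx).mul_const d).sub (((hlim hx).pow 2).const_mul (2 * ‖x - a‖ ^ 2))
    have hpos := norm_pos_iff.2 (sub_ne_zero.2 hx)
    convert h using 2
    field_simp

end PoleField

section SumPoleField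

variable {E : Type*} [NormedAddCommGroup E] [InnerProductSpace ℝ E]

lemma add_sq_le_one_add_mul_add (y z : ℝ) {δ : ℝ} (hδ : 0 < δ) :
    (y + z) ^ 2 ≤ (1 + δ) * y ^ 2 + (1 + δ⁻¹) * z ^ 2 := by
  have hsq : (1 + δ) * y ^ 2 + (1 + δ⁻¹) * z ^ 2 - (y + z) ^ 2 = δ⁻¹ * (δ * y - z) ^ 2 := by
    field_simp
    ring
  have : 0 ≤ δ⁻¹ * (δ * y - z) ^ 2 := by positivity
  linarith

lemma norm_poleField_le {a b x : E} (hab : a ≠ b) (hx : ‖x - b‖ ≤ ‖x - a‖) :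
    ‖poleField a x‖ ≤ 2 / ‖a - b‖ := by
  have hpos := norm_pos_iff.2 (sub_ne_zero.2 hab)
  have htri := norm_sub_le_norm_sub_add_norm_sub a x b
  rw [norm_poleField, ← inv_div]
  gcongr
  linarith [norm_sub_rev a x]

-- Near one pole the other fields are bounded, so only one summand can be large at a time.
lemma exists_norm_sum_poleField_sq_le {ι : Type*} [Fintype ι] {a : ι → E}
    (ha : Function.Injective a) {δ : ℝ} (hδ : 0 < δ) :
    ∃ C : ℝ, ∀ x, ‖∑ i, poleField (a i) x‖ ^ 2 ≤ (1 + δ) * ∑ i, (‖x - a i‖ ^ 2)⁻¹ + C := by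
  classical
  set K : ℝ := ∑ i, ∑ j, 2 / ‖a j - a i‖ with hK
  refine ⟨(1 + δ⁻¹) * K ^ 2, fun x => ?_⟩
  cases isEmpty_or_nonempty ι with
  | inl _ =>
    simp [hK]
  | inr _ =>
    obtain ⟨i, hi⟩ := Finite.exists_min fun i => ‖x - a i‖
    have hfar : ∑ j ∈ Finset.univ.erase i, ‖poleField (a j) x‖ ≤ K :=
      calc ∑ j ∈ Finset.univ.erase i, ‖poleField (a j) x‖
          ≤ ∑ j ∈ Finset.univ.erase i, 2 / ‖a j - a i‖ := Finset.sum_le_sum fun j hj =>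
            norm_poleField_le (ha.ne (Finset.ne_of_mem_erase hj)) (hi j)
        _ ≤ ∑ j, 2 / ‖a j - a i‖ := Finset.sum_le_sum_of_subset_of_nonneg (Finset.subset_univ _)
            fun _ _ _ => by positivity
        _ ≤ K := Finset.single_le_sum (f := fun i => ∑ j, 2 / ‖a j - a i‖)
            (fun _ _ => by positivity) (Finset.mem_univ i)
    have hnear : ‖poleField (a i) x‖ ^ 2 ≤ ∑ i, (‖x - a i‖ ^ 2)⁻¹ := by
      rw [norm_poleField_sq]
      exact Finset.single_le_sum (f := fun i => (‖x - a i‖ ^ 2)⁻¹) (fun _ _ => by positivity)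
        (Finset.mem_univ i)
    calc ‖∑ j, poleField (a j) x‖ ^ 2 ≤ (‖poleField (a i) x‖ + K) ^ 2 := by
          rw [← Finset.add_sum_erase _ _ (Finset.mem_univ i)]
          gcongr
          exact (norm_add_le _ _).trans (by gcongr; exact (norm_sum_le _ _).trans hfar)
      _ ≤ (1 + δ) * ‖poleField (a i) x‖ ^ 2 + (1 + δ⁻¹) * K ^ 2 :=
          add_sq_le_one_add_mul_add _ _ hδ
      _ ≤ _ := by gcongr

lemma hasWeakDivergence_smul_sum_poleField [FiniteDimensional ℝ E] [MeasurableSpace E]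
    [BorelSpace E] {ι : Type*} [Fintype ι] (hE : 2 < Module.finrank ℝ E) (a : ι → E) (α : ℝ) :
    HasWeakDivergence (fun x => α • ∑ i, poleField (a i) x)
      fun x => α * (Module.finrank ℝ E - 2) * ∑ i, (‖x - a i‖ ^ 2)⁻¹ := by
  convert (HasWeakDivergence.sum Finset.univ fun i _ =>
    hasWeakDivergence_poleField hE (a i)).const_smul α using 2
  · simp
  · simp [Finset.mul_sum, mul_assoc]

lemma sum_Ioi_norm_sub_sq {n : ℕ} (v : Fin n → E) :
    ∑ i, ∑ j ∈ Finset.Ioi i, ‖v i - v j‖ ^ 2 = n * ∑ i, ‖v i‖ ^ 2 - ‖∑ i, v i‖ ^ 2 := by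
  have hpairs : ∑ i, ∑ j, ‖v j - v i‖ ^ 2 = 2 * ∑ i, ∑ j ∈ Finset.Ioi i, ‖v i - v j‖ ^ 2 := by
    have hdiag (i) : ∑ j ∈ {i}ᶜ, ‖v j - v i‖ ^ 2 = ∑ j, ‖v j - v i‖ ^ 2 :=
      Finset.sum_subset (Finset.subset_univ _) fun j _ hj => by
        rw [show j = i by simpa using hj, sub_self, norm_zero, zero_pow two_ne_zero]
    simp_rw [← hdiag, ← Finset.sum_sum_Ioi_add_eq_sum_sum_off_diag fun i j => ‖v i - v j‖ ^ 2,
      Finset.mul_sum, norm_sub_rev, two_mul]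
  have hexpand : ∑ i, ∑ j, ‖v j - v i‖ ^ 2 = 2 * (n * ∑ i, ‖v i‖ ^ 2 - ‖∑ i, v i‖ ^ 2) := by
    simp_rw [norm_sub_sq_real, Finset.sum_add_distrib, Finset.sum_sub_distrib, ← Finset.mul_sum,
      ← sum_inner, ← inner_sum]
    simp only [Finset.sum_const, Finset.card_univ, Fintype.card_fin, nsmul_eq_mul,
      inner_self_eq_norm_sq_to_K, Real.ringHom_apply, ← Finset.mul_sum]
    ring
  linarith

end SumPoleField

section Potential

variable {N n : ℕ} {a : Fin n → EuclideanSpace ℝ (Fin N)}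

lemma two_lt_finrank_euclideanSpace (hN : 3 ≤ N) :
    2 < Module.finrank ℝ (EuclideanSpace ℝ (Fin N)) := by
  rwa [finrank_euclideanSpace_fin]

lemma ae_forall_ne (hN : 3 ≤ N) (a : Fin n → EuclideanSpace ℝ (Fin N)) :
    ∀ᵐ x : EuclideanSpace ℝ (Fin N), ∀ i, x ≠ a i := by
  have : Nontrivial (EuclideanSpace ℝ (Fin N)) :=
    Module.nontrivial_of_finrank_pos (R := ℝ) (by simp; omega)
  exact ae_all_iff.2 fun i => Measure.ae_ne volume (a i)

lemma potential_nonneg (a : Fin n → EuclideanSpace ℝ (Fin N)) (x : EuclideanSpace ℝ (Fin N)) :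
    0 ≤ potential a x :=
  Finset.sum_nonneg fun _ _ => Finset.sum_nonneg fun _ _ => by positivity

lemma measurable_potential (a : Fin n → EuclideanSpace ℝ (Fin N)) : Measurable (potential a) := by
  unfold potential
  fun_prop

lemma le_potential (a : Fin n → EuclideanSpace ℝ (Fin N)) (x : EuclideanSpace ℝ (Fin N))
    {i j : Fin n} (hij : i < j) :
    ‖a i - a j‖ ^ 2 / (‖x - a i‖ ^ 2 * ‖x - a j‖ ^ 2) ≤ potential a x :=
  (Finset.single_le_sum (f := fun j => ‖a i - a j‖ ^ 2 / (‖x - a i‖ ^ 2 * ‖x - a j‖ ^ 2))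
      (fun _ _ => by positivity) (Finset.mem_Ioi.2 hij)).trans <|
    Finset.single_le_sum (f := fun i => ∑ j ∈ Finset.Ioi i, ‖a i - a j‖ ^ 2 /
      (‖x - a i‖ ^ 2 * ‖x - a j‖ ^ 2)) (fun _ _ => by positivity) (Finset.mem_univ i)

lemma potential_pos (hn : 2 ≤ n) (ha : Function.Injective a) {x : EuclideanSpace ℝ (Fin N)}
    (hx : ∀ i, x ≠ a i) : 0 < potential a x := by
  have hij : (⟨0, by omega⟩ : Fin n) < ⟨1, by omega⟩ := by simp [Fin.lt_def]
  have hij' := sub_ne_zero.2 (ha.ne hij.ne)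
  have hi := sub_ne_zero.2 (hx ⟨0, by omega⟩)
  have hj := sub_ne_zero.2 (hx ⟨1, by omega⟩)
  exact lt_of_lt_of_le (by positivity) (le_potential a x hij)

lemma potential_eq {x : EuclideanSpace ℝ (Fin N)} (hx : ∀ i, x ≠ a i) :
    potential a x = n * ∑ i, (‖x - a i‖ ^ 2)⁻¹ - ‖∑ i, poleField (a i) x‖ ^ 2 := by
  simp_rw [← norm_poleField_sq, ← sum_Ioi_norm_sub_sq, norm_poleField_sub_sq (hx _) (hx _),
    potential]

lemma locallyIntegrable_potential (hN : 3 ≤ N) (a : Fin n → EuclideanSpace ℝ (Fin N)) :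
    LocallyIntegrable (potential a) := by
  have hsum : LocallyIntegrable fun x => ∑ i, (‖x - a i‖ ^ 2)⁻¹ :=
    locallyIntegrable_finsetSum _ fun i _ =>
      locallyIntegrable_inv_norm_sub_sq (two_lt_finrank_euclideanSpace hN) (a i)
  refine (hsum.smul (n : ℝ)).mono (measurable_potential a).aestronglyMeasurable ?_
  filter_upwards [ae_forall_ne hN a] with x hx
  rw [Real.norm_of_nonneg (potential_nonneg a x), potential_eq hx]
  exact (sub_le_self _ (sq_nonneg _)).trans (Real.le_norm_self _)

lemma integrable_potential_mul_sq (hN : 3 ≤ N) (a : Fin n → EuclideanSpace ℝ (Fin N))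
    {u : EuclideanSpace ℝ (Fin N) → ℝ} (hu : Continuous u) (hu' : HasCompactSupport u) :
    Integrable fun x => potential a x * u x ^ 2 :=
  (locallyIntegrable_potential hN a).integrable_smul_right_of_hasCompactSupport (hu.pow 2)
    (hasCompactSupport_sq hu')

end Potential

section WeakHardy

variable {N n : ℕ} {a : Fin n → EuclideanSpace ℝ (Fin N)}

lemma exists_mul_potential_le (hN : 3 ≤ N) (hn : 2 ≤ n) (ha : Function.Injective a) {μ : ℝ}
    (hμ : μ < ((N : ℝ) - 2) ^ 2 / (4 * n - 4)) :
    ∃ C : ℝ, ∀ x, (∀ i, x ≠ a i) → μ * potential a x ≤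
      ((N : ℝ) - 2) / 2 * (N - 2) * (∑ i, (‖x - a i‖ ^ 2)⁻¹) -
        ‖(((N : ℝ) - 2) / 2) • ∑ i, poleField (a i) x‖ ^ 2 + C := by
  have hN' : (3 : ℝ) ≤ N := by exact_mod_cast hN
  have hn' : (2 : ℝ) ≤ n := by exact_mod_cast hn
  set α : ℝ := ((N : ℝ) - 2) / 2 with hα
  have hα0 : 0 < α ^ 2 := pow_pos (by linarith) 2
  have hμα : μ * (n - 1) < α ^ 2 := by
    rw [lt_div_iff₀ (by linarith)] at hμ
    rw [hα]
    nlinarith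
  have hgap : 0 < α ^ 2 - μ := by
    rcases le_or_gt μ 0 with h | h
    · linarith
    · nlinarith
  set δ : ℝ := (α ^ 2 - μ * (n - 1)) / (α ^ 2 - μ) with hδ
  obtain ⟨C, hC⟩ := exists_norm_sum_poleField_sq_le ha (δ := δ) (div_pos (by linarith) hgap)
  refine ⟨(α ^ 2 - μ) * C, fun x hx => ?_⟩
  rw [potential_eq hx, norm_smul, mul_pow, Real.norm_eq_abs, sq_abs]
  have hbound := mul_le_mul_of_nonneg_left (hC x) hgap.le
  set S := ∑ i, (‖x - a i‖ ^ 2)⁻¹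
  set Y := ‖∑ i, poleField (a i) x‖ ^ 2
  have hcoeff : (α ^ 2 - μ) * ((1 + δ) * S + C) = (2 * α ^ 2 - n * μ) * S + (α ^ 2 - μ) * C := by
    rw [hδ]
    field_simp
    ring
  rw [show α * (N - 2) = 2 * α ^ 2 by rw [hα]; ring]
  linarith

lemma exists_mul_integral_potential_mul_sq_le (hN : 3 ≤ N) (hn : 2 ≤ n)
    (ha : Function.Injective a) {μ : ℝ} (hμ : μ < ((N : ℝ) - 2) ^ 2 / (4 * n - 4)) :
    ∃ c : ℝ, ∀ u : EuclideanSpace ℝ (Fin N) → ℝ, ContDiff ℝ 1 u → HasCompactSupport u →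
      μ * ∫ x, potential a x * u x ^ 2 ≤ c * (∫ x, u x ^ 2) + ∫ x, ‖∇ u x‖ ^ 2 := by
  obtain ⟨C, hC⟩ := exists_mul_potential_le hN hn ha hμ
  refine ⟨C, fun u hu hu' => ?_⟩
  have hfield := hasWeakDivergence_smul_sum_poleField (two_lt_finrank_euclideanSpace hN) a
    (((N : ℝ) - 2) / 2)
  rw [finrank_euclideanSpace_fin] at hfield
  have hsq : Integrable fun x => u x ^ 2 :=
    (hu.continuous.pow 2).integrable_of_hasCompactSupport (hasCompactSupport_sq hu')
  have hint := hfield.integrable_div_sub_norm_sq_mul (u := fun x => u x ^ 2)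
    (hu.continuous.pow 2) (hasCompactSupport_sq hu')
  calc μ * ∫ x, potential a x * u x ^ 2 = ∫ x, μ * (potential a x * u x ^ 2) :=
        (integral_const_mul _ _).symm
    _ ≤ ∫ x, (C * u x ^ 2 + (((N : ℝ) - 2) / 2 * (N - 2) * (∑ i, (‖x - a i‖ ^ 2)⁻¹) -
          ‖(((N : ℝ) - 2) / 2) • ∑ i, poleField (a i) x‖ ^ 2) * u x ^ 2) := by
        refine integral_mono_ae ((integrable_potential_mul_sq hN a hu.continuous hu').const_mul μ)
          ((hsq.const_mul C).add hint) ?_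
        filter_upwards [ae_forall_ne hN a] with x hx
        rw [← mul_assoc, ← add_mul]
        exact mul_le_mul_of_nonneg_right ((hC x hx).trans_eq (add_comm _ _)) (sq_nonneg _)
    _ ≤ _ := by
        rw [integral_add (hsq.const_mul C) hint, integral_const_mul]
        refine add_le_add_right ?_ _
        exact hfield.integral_div_sub_norm_sq_mul_sq_le hu hu'

end WeakHardy

section TwoPoles

lemma exists_norm_eq_one_inner_eq_zero {E : Type*} [NormedAddCommGroup E] [InnerProductSpace ℝ E]
    (hE : 1 < Module.finrank ℝ E) (v : E) : ∃ e : E, ‖e‖ = 1 ∧ inner ℝ e v = 0 := by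
  have := Module.finite_of_finrank_pos (R := ℝ) (M := E) (by omega)
  obtain ⟨w, hw, hw0⟩ : ∃ w ∈ (ℝ ∙ v)ᗮ, w ≠ 0 := by
    refine Submodule.exists_mem_ne_zero_of_ne_bot fun h => ?_
    rw [Submodule.orthogonal_eq_bot_iff] at h
    have hspan : Module.finrank ℝ (ℝ ∙ v) ≤ 1 := (finrank_span_le_card _).trans (by simp)
    rw [h, finrank_top] at hspan
    omega
  refine ⟨‖w‖⁻¹ • w, norm_smul_inv_norm hw0, ?_⟩
  rw [real_inner_smul_left, real_inner_comm,
    Submodule.mem_orthogonal_singleton_iff_inner_right.1 hw, mul_zero]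

variable {N : ℕ} {a : Fin 2 → EuclideanSpace ℝ (Fin N)}

/-- The field `α Y + δ ⟨e, x - a₀⟩^(2N+1) e` with `Y` the sum of the two pole fields and
`α = (N - 2) / 2`. Its second term improves the Hardy inequality for two poles when `e` is a unit
vector orthogonal to `a₀ - a₁` and `δ` is small. -/
def twoPoleField (a : Fin 2 → EuclideanSpace ℝ (Fin N)) (e : EuclideanSpace ℝ (Fin N)) (δ : ℝ)
    (x : EuclideanSpace ℝ (Fin N)) : EuclideanSpace ℝ (Fin N) :=
  (((N : ℝ) - 2) / 2) • ∑ i, poleField (a i) x + (δ * inner ℝ e (x - a 0) ^ (2 * N + 1)) • e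

/-- The divergence of `twoPoleField a e δ` for a unit vector `e`. -/
def twoPoleDiv (a : Fin 2 → EuclideanSpace ℝ (Fin N)) (e : EuclideanSpace ℝ (Fin N)) (δ : ℝ)
    (x : EuclideanSpace ℝ (Fin N)) : ℝ :=
  ((N : ℝ) - 2) / 2 * (N - 2) * ∑ i, (‖x - a i‖ ^ 2)⁻¹ +
    δ * ((2 * N + 1) * inner ℝ e (x - a 0) ^ (2 * N))

variable {e : EuclideanSpace ℝ (Fin N)} {δ : ℝ}

lemma hasWeakDivergence_twoPoleField (hN : 3 ≤ N) (he : ‖e‖ = 1) :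
    HasWeakDivergence (twoPoleField a e δ) (twoPoleDiv a e δ) := by
  convert (hasWeakDivergence_smul_sum_poleField (two_lt_finrank_euclideanSpace hN) a
    (((N : ℝ) - 2) / 2)).add ((hasWeakDivergence_inner_pow_smul e (a 0) (2 * N)).const_smul δ)
    using 1
  · ext1 x
    simp [twoPoleField, mul_smul]
  · ext1 x
    simp [twoPoleDiv, he]

-- Since `e` is orthogonal to `a 0 - a 1`, both `⟨e, x - a i⟩` equal `t = ⟨e, x - a 0⟩`, so the
-- mixed term of `‖twoPoleField‖ ^ 2` is `2 α δ t ^ (2 N + 2) ∑ i, ‖x - a i‖⁻² ≤ 4 α δ t ^ (2 N)`.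
lemma mul_potential_add_le_twoPoleDiv_sub (hN : 3 ≤ N) (he : ‖e‖ = 1)
    (hea : inner ℝ e (a 0 - a 1) = 0) (hδ : 0 ≤ δ) {x : EuclideanSpace ℝ (Fin N)}
    (hx : ∀ i, x ≠ a i) (hδx : δ * inner ℝ e (x - a 0) ^ (2 * N + 2) ≤ 1) :
    ((N : ℝ) - 2) ^ 2 / 4 * potential a x + 4 * δ * inner ℝ e (x - a 0) ^ (2 * N) ≤
      twoPoleDiv a e δ x - ‖twoPoleField a e δ x‖ ^ 2 := by
  have hN' : (3 : ℝ) ≤ N := by exact_mod_cast hN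
  set t : ℝ := inner ℝ e (x - a 0) with ht
  have hinner : ∀ i, inner ℝ e (x - a i) = t := by
    have h1 : inner ℝ e (x - a 1) = t := by
      rw [← sub_add_sub_cancel x (a 0), inner_add_right, hea, add_zero]
    exact Fin.forall_fin_two.2 ⟨rfl, h1⟩
  have ht_le (i) : t ^ 2 * (‖x - a i‖ ^ 2)⁻¹ ≤ 1 := by
    have hpos := norm_pos_iff.2 (sub_ne_zero.2 (hx i))
    have hcauchy := abs_real_inner_le_norm e (x - a i)
    rw [hinner, he, one_mul] at hcauchy
    rw [← div_eq_mul_inv, div_le_one (by positivity), ← sq_abs t]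
    gcongr
  have hsum : t ^ 2 * ∑ i, (‖x - a i‖ ^ 2)⁻¹ ≤ 2 := by
    rw [Fin.sum_univ_two, mul_add]
    linarith [ht_le 0, ht_le 1]
  have hYe : inner ℝ (∑ i, poleField (a i) x) e = t * ∑ i, (‖x - a i‖ ^ 2)⁻¹ := by
    rw [real_inner_comm, inner_sum, Finset.mul_sum]
    exact Finset.sum_congr rfl fun i _ => by rw [poleField, real_inner_smul_right, hinner, mul_comm]
  rw [twoPoleDiv, twoPoleField, potential_eq hx, norm_add_sq_real, real_inner_smul_left,
    real_inner_smul_right, hYe, norm_smul, norm_smul, he, mul_one, mul_pow, Real.norm_eq_abs,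
    Real.norm_eq_abs, sq_abs, sq_abs, ← ht, pow_succ t (2 * N)]
  rw [pow_add] at hδx
  have htN : 0 ≤ t ^ (2 * N) := (even_two_mul N).pow_nonneg t
  set S := ∑ i, (‖x - a i‖ ^ 2)⁻¹
  set Y := ‖∑ i, poleField (a i) x‖ ^ 2
  set q := t ^ (2 * N)
  have hmixed : ((N : ℝ) - 2) * δ * q * (t ^ 2 * S) ≤ (N - 2) * δ * q * 2 := by
    have : (0 : ℝ) ≤ N - 2 := by linarith
    gcongr
  have hsquare : δ * q * (δ * (q * t ^ 2)) ≤ δ * q * 1 := by gcongr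
  push_cast
  nlinarith [mul_nonneg hδ htN]

lemma ae_inner_sub_ne_zero {E : Type*} [NormedAddCommGroup E] [InnerProductSpace ℝ E]
    [FiniteDimensional ℝ E] [MeasurableSpace E] [BorelSpace E] {e : E} (he : e ≠ 0) (p : E) :
    ∀ᵐ x : E, inner ℝ e (x - p) ≠ 0 := by
  have hplane : volume (((ℝ ∙ e)ᗮ : Submodule ℝ E) : Set E) = 0 :=
    Measure.addHaar_submodule _ _ fun h => he <| by
      rwa [Submodule.orthogonal_eq_top_iff, Submodule.span_singleton_eq_bot] at h
  have hshift := (measurePreserving_sub_right volume p).quasiMeasurePreserving.ae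
    (measure_eq_zero_iff_ae_notMem.1 hplane)
  filter_upwards [hshift] with x hx h
  exact hx (Submodule.mem_orthogonal_singleton_iff_inner_right.2 h)

lemma mul_inner_pow_le_one {E : Type*} [NormedAddCommGroup E] [InnerProductSpace ℝ E] {e v : E}
    (he : ‖e‖ = 1) {T : ℝ} (hT : 0 < T) (hv : ‖v‖ ≤ T) (k : ℕ) :
    (T ^ (2 * k))⁻¹ * inner ℝ e v ^ (2 * k) ≤ 1 := by
  have hcauchy := (abs_real_inner_le_norm e v).trans (by rwa [he, one_mul] : ‖e‖ * ‖v‖ ≤ T)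
  rw [inv_mul_le_one₀ (by positivity), ← (even_two_mul k).pow_abs]
  gcongr

lemma exists_two_pole_hardy_weight (hN : 3 ≤ N) (a : Fin 2 → EuclideanSpace ℝ (Fin N))
    {s : Set (EuclideanSpace ℝ (Fin N))} (hs : Bornology.IsBounded s) :
    ∃ W : EuclideanSpace ℝ (Fin N) → ℝ, LocallyIntegrable W ∧
      (∀ᵐ x, x ∈ s → ((N : ℝ) - 2) ^ 2 / 4 * potential a x < W x) ∧
      ∀ u, ContDiff ℝ 1 u → HasCompactSupport u → ∫ x, W x * u x ^ 2 ≤ ∫ x, ‖∇ u x‖ ^ 2 := by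
  obtain ⟨R, hR, hsR⟩ := hs.exists_pos_norm_le
  obtain ⟨e, he, hea⟩ := exists_norm_eq_one_inner_eq_zero
    (one_lt_two.trans (two_lt_finrank_euclideanSpace hN)) (a 0 - a 1)
  set T : ℝ := R + ‖a 0‖
  have hT : 0 < T := by positivity
  set δ : ℝ := (T ^ (2 * (N + 1)))⁻¹
  have hδ : 0 < δ := by positivity
  have hfield := hasWeakDivergence_twoPoleField (a := a) (δ := δ) hN he
  refine ⟨fun x => twoPoleDiv a e δ x - ‖twoPoleField a e δ x‖ ^ 2,
    hfield.locallyIntegrable_div.sub hfield.locallyIntegrable_norm_sq, ?_,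
    fun u hu hu' => hfield.integral_div_sub_norm_sq_mul_sq_le hu hu'⟩
  filter_upwards [ae_forall_ne hN a, ae_inner_sub_ne_zero (norm_ne_zero_iff.1 (he ▸ one_ne_zero))
    (a 0)] with x hx hxe hxs
  have hxT : ‖x - a 0‖ ≤ T := (norm_sub_le _ _).trans (add_le_add_left (hsR x hxs) _)
  have hremainder : 0 < 4 * δ * inner ℝ e (x - a 0) ^ (2 * N) :=
    mul_pos (by positivity) ((even_two_mul N).pow_pos hxe)
  linarith [mul_potential_add_le_twoPoleDiv_sub hN he hea hδ.le hx
    (mul_inner_pow_le_one he hT hxT (N + 1))]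

end TwoPoles

lemma lintegral_le_of_tendsto_ae {X : Type*} [MeasurableSpace X] {ν : Measure X}
    {f : ℕ → X → ℝ≥0∞} {g : X → ℝ≥0∞} {b : ℕ → ℝ≥0∞} {B : ℝ≥0∞}
    (hf : ∀ k, AEMeasurable (f k) ν)
    (hlim : ∀ᵐ x ∂ν, Tendsto (fun k => f k x) atTop (𝓝 (g x)))
    (hle : ∀ k, ∫⁻ x, f k x ∂ν ≤ b k) (hb : Tendsto b atTop (𝓝 B)) :
    ∫⁻ x, g x ∂ν ≤ B :=
  calc ∫⁻ x, g x ∂ν = ∫⁻ x, liminf (fun k => f k x) atTop ∂ν :=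
        lintegral_congr_ae (by filter_upwards [hlim] with x hx using hx.liminf_eq.symm)
    _ ≤ liminf (fun k => ∫⁻ x, f k x ∂ν) atTop := lintegral_liminf_le' hf
    _ ≤ liminf b atTop := liminf_le_liminf (Eventually.of_forall hle)
    _ = B := hb.liminf_eq

section Concentration

variable {E : Type*} [NormedAddCommGroup E] {p : E} {α ε : ℝ}

/-- The function `x ↦ ‖x - p‖ ^ (-α)`, regularised at `p` by `ε`. For `α = (d - 2) / 2` in dimension
`d` it is a virtual ground state of the Hardy inequality with pole `p`. -/
def regularizedPow (p : E) (α ε : ℝ) (x : E) : ℝ := (‖x - p‖ ^ 2 + ε) ^ (-α / 2)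

lemma regularizedPow_sq (hε : 0 < ε) (x : E) :
    regularizedPow p α ε x ^ 2 = (‖x - p‖ ^ 2 + ε) ^ (-α) := by
  rw [regularizedPow, ← Real.rpow_mul_natCast (by positivity)]
  congr 1
  push_cast
  ring

variable [InnerProductSpace ℝ E]

lemma gradient_mul_apply [CompleteSpace E] {f g : E → ℝ} {x : E} (hf : DifferentiableAt ℝ f x)
    (hg : DifferentiableAt ℝ g x) :
    ∇ (fun y => f y * g y) x = f x • ∇ g x + g x • ∇ f x := by
  rw [gradient, fderiv_fun_mul hf hg]
  simp [gradient]

lemma norm_gradient_mul_sq_le [CompleteSpace E] {f g : E → ℝ} {x : E}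
    (hf : DifferentiableAt ℝ f x) (hg : DifferentiableAt ℝ g x) {θ : ℝ} (hθ : 0 < θ) :
    ‖∇ (fun y => f y * g y) x‖ ^ 2 ≤
      (1 + θ) * (f x ^ 2 * ‖∇ g x‖ ^ 2) + (1 + θ⁻¹) * (g x ^ 2 * ‖∇ f x‖ ^ 2) := by
  calc ‖∇ (fun y => f y * g y) x‖ ^ 2 ≤ (‖f x • ∇ g x‖ + ‖g x • ∇ f x‖) ^ 2 := by
        rw [gradient_mul_apply hf hg]
        gcongr
        exact norm_add_le _ _
    _ ≤ (1 + θ) * ‖f x • ∇ g x‖ ^ 2 + (1 + θ⁻¹) * ‖g x • ∇ f x‖ ^ 2 :=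
        add_sq_le_one_add_mul_add _ _ hθ
    _ = _ := by simp only [norm_smul, mul_pow, Real.norm_eq_abs, sq_abs]

lemma contDiff_regularizedPow (hε : 0 < ε) {m : WithTop ℕ∞} :
    ContDiff ℝ m (regularizedPow p α ε) :=
  ((((contDiff_id.sub contDiff_const).norm_sq ℝ).add contDiff_const).rpow_const_of_ne
    fun x => by simp only [id]; positivity)

lemma norm_gradient_regularizedPow_sq [CompleteSpace E] (hε : 0 < ε) (x : E) :
    ‖∇ (regularizedPow p α ε) x‖ ^ 2 =
      α ^ 2 * (‖x - p‖ ^ 2 * (‖x - p‖ ^ 2 + ε) ^ (-α - 2)) := by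
  have hpos : 0 < ‖x - p‖ ^ 2 + ε := by positivity
  have hbase : HasFDerivAt (fun x => ‖x - p‖ ^ 2 + ε) ((2 : ℝ) • innerSL ℝ (x - p)) x := by
    simpa [ofNat_smul_eq_nsmul] using ((hasFDerivAt_id x).sub_const p).norm_sq.add_const ε
  have hpow := hbase.rpow_const (p := -α / 2) (Or.inl hpos.ne')
  have hexp : ((‖x - p‖ ^ 2 + ε) ^ (-α / 2 - 1)) ^ 2 = (‖x - p‖ ^ 2 + ε) ^ (-α - 2) := by
    rw [← Real.rpow_mul_natCast hpos.le]
    congr 1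
    push_cast
    ring
  rw [gradient, LinearIsometryEquiv.norm_map, HasFDerivAt.fderiv (f := regularizedPow p α ε) hpow,
    norm_smul, norm_smul, innerSL_apply_norm, mul_pow, mul_pow, Real.norm_eq_abs, sq_abs, mul_pow,
    hexp, Real.norm_ofNat]
  ring

lemma norm_gradient_regularizedPow_sq_le [CompleteSpace E] (hε : 0 < ε) {x : E} (hx : x ≠ p) :
    ‖∇ (regularizedPow p α ε) x‖ ^ 2 ≤
      α ^ 2 * ((‖x - p‖ ^ 2)⁻¹ * regularizedPow p α ε x ^ 2) := by
  have hr : 0 < ‖x - p‖ ^ 2 := pow_pos (norm_pos_iff.2 (sub_ne_zero.2 hx)) 2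
  have hpos : 0 < ‖x - p‖ ^ 2 + ε := by positivity
  rw [norm_gradient_regularizedPow_sq hε, regularizedPow_sq hε, Real.rpow_sub hpos, Real.rpow_two,
    inv_mul_eq_div, ← mul_div_assoc]
  refine mul_le_mul_of_nonneg_left ?_ (sq_nonneg α)
  rw [div_le_div_iff₀ (by positivity) hr, mul_comm, mul_comm (‖x - p‖ ^ 2), ← sub_nonneg]
  have : 0 ≤ (‖x - p‖ ^ 2 + ε) ^ (-α) * (2 * ‖x - p‖ ^ 2 * ε + ε ^ 2) := by positivity
  linarith

lemma tendsto_norm_gradient_regularizedPow_sq [CompleteSpace E] {ι : Type*} {l : Filter ι}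
    {ε : ι → ℝ} (hε : ∀ i, 0 < ε i) (hε0 : Tendsto ε l (𝓝 0)) {x : E} (hx : x ≠ p) :
    Tendsto (fun i => ‖∇ (regularizedPow p α (ε i)) x‖ ^ 2) l
      (𝓝 (α ^ 2 * ‖x - p‖ ^ (-2 * α - 2))) := by
  have hr := norm_pos_iff.2 (sub_ne_zero.2 hx)
  have hbase : Tendsto (fun i => ‖x - p‖ ^ 2 + ε i) l (𝓝 (‖x - p‖ ^ 2)) := by
    simpa using hε0.const_add (‖x - p‖ ^ 2)
  have hlim : ‖x - p‖ ^ 2 * (‖x - p‖ ^ 2) ^ (-α - 2) = ‖x - p‖ ^ (-2 * α - 2) := by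
    rw [← Real.rpow_two, ← Real.rpow_mul hr.le, ← Real.rpow_add hr]
    congr 1
    ring
  simp_rw [norm_gradient_regularizedPow_sq (hε _), ← hlim]
  exact ((hbase.rpow_const (Or.inl (by positivity))).const_mul _).const_mul _

variable [FiniteDimensional ℝ E]

lemma regularizedPow_sq_mul_norm_gradient_bump_sq_le (η : ContDiffBump p) (hα : 0 ≤ α)
    (hε : 0 < ε) (x : E) :
    regularizedPow p α ε x ^ 2 * ‖∇ η x‖ ^ 2 ≤ (η.rIn ^ 2) ^ (-α) * ‖∇ η x‖ ^ 2 := by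
  by_cases hx : x ∈ Metric.ball p η.rIn
  · have hconst : (η : E → ℝ) =ᶠ[𝓝 x] fun _ => 1 := by
      filter_upwards [Metric.isOpen_ball.mem_nhds hx] with y hy
      exact η.one_of_mem_closedBall (Metric.ball_subset_closedBall hy)
    simp [hconst.gradient_eq]
  · have hrIn : η.rIn ≤ ‖x - p‖ := by rwa [Metric.mem_ball, not_lt, dist_eq_norm] at hx
    have hsq : η.rIn ^ 2 ≤ ‖x - p‖ ^ 2 := pow_le_pow_left₀ η.rIn_pos.le hrIn 2
    rw [regularizedPow_sq hε]
    refine mul_le_mul_of_nonneg_right ?_ (sq_nonneg _)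
    exact Real.rpow_le_rpow_of_nonpos (pow_pos η.rIn_pos 2)
      (hsq.trans (le_add_of_nonneg_right hε.le)) (neg_nonpos.2 hα)

variable [MeasurableSpace E] [BorelSpace E]

lemma not_integrableOn_norm_sub_rpow_neg_finrank [Nontrivial E] (p : E) {ρ : ℝ} (hρ : 0 < ρ) :
    ¬ IntegrableOn (fun x => ‖x - p‖ ^ (-(Module.finrank ℝ E : ℝ))) (Metric.ball p ρ) := by
  intro h
  have hcentred : IntegrableOn (fun x : E => ‖x‖ ^ (-(Module.finrank ℝ E : ℝ)))
      (Metric.ball 0 ρ) := by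
    rw [← integrable_indicator_iff measurableSet_ball] at h ⊢
    refine (h.comp_add_right p).congr (Eventually.of_forall fun x => ?_)
    simp [Set.indicator, Metric.mem_ball, dist_eq_norm]
  rw [integrableOn_fun_norm_addHaar volume (f := fun y => y ^ (-(Module.finrank ℝ E : ℝ)))]
    at hcentred
  have hradial : IntegrableOn (fun y : ℝ => y ^ (-1 : ℝ)) (Set.Ioo 0 ρ) := by
    refine hcentred.congr_fun (fun y hy => ?_) measurableSet_Ioo
    simp only [smul_eq_mul]
    rw [← Real.rpow_natCast, ← Real.rpow_add hy.1, Nat.cast_sub Module.finrank_pos]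
    congr 1
    push_cast
    ring
  exact lt_irrefl _ ((intervalIntegral.integrableOn_Ioo_rpow_iff hρ).1 hradial)

lemma integrable_mul_norm_gradient_regularizedPow_sq (η : ContDiffBump p) (hε : 0 < ε) :
    Integrable fun x => η x ^ 2 * ‖∇ (regularizedPow p α ε) x‖ ^ 2 :=
  ((η.continuous.pow 2).mul ((continuous_gradient (contDiff_regularizedPow hε)).norm.pow 2))
    |>.integrable_of_hasCompactSupport (hasCompactSupport_sq η.hasCompactSupport).mul_right

-- By Fatou a bound independent of `ε` would make `‖x - p‖ ^ (-d)` integrable near `p`.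
lemma exists_lt_integral_mul_norm_gradient_regularizedPow_sq (hE : 2 < Module.finrank ℝ E)
    (η : ContDiffBump p) (B : ℝ) : ∃ ε : ℝ, 0 < ε ∧
      B < ∫ x, η x ^ 2 * ‖∇ (regularizedPow p (((Module.finrank ℝ E : ℝ) - 2) / 2) ε) x‖ ^ 2 := by
  have : Nontrivial E := Module.nontrivial_of_finrank_pos (R := ℝ) (by omega)
  have hE' : (2 : ℝ) < Module.finrank ℝ E := by exact_mod_cast hE
  set α : ℝ := ((Module.finrank ℝ E : ℝ) - 2) / 2 with hα
  have hα0 : 0 < α := by linarith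
  by_contra! hbdd
  set ε : ℕ → ℝ := fun k => 1 / ((k : ℝ) + 1)
  have hε (k) : 0 < ε k := by positivity
  have hle (k) : ∫⁻ x in Metric.ball p η.rIn,
      ENNReal.ofReal (η x ^ 2 * ‖∇ (regularizedPow p α (ε k)) x‖ ^ 2) ≤ ENNReal.ofReal B := by
    refine (setLIntegral_le_lintegral _ _).trans ?_
    rw [← ofReal_integral_eq_lintegral_ofReal
      (integrable_mul_norm_gradient_regularizedPow_sq η (hε k))
      (Eventually.of_forall fun x => by positivity)]
    exact ENNReal.ofReal_le_ofReal (hbdd (ε k) (hε k))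
  have hlim : ∀ᵐ x ∂volume.restrict (Metric.ball p η.rIn),
      Tendsto (fun k => ENNReal.ofReal (η x ^ 2 * ‖∇ (regularizedPow p α (ε k)) x‖ ^ 2)) atTop
        (𝓝 (ENNReal.ofReal (α ^ 2 * ‖x - p‖ ^ (-(Module.finrank ℝ E : ℝ))))) := by
    filter_upwards [ae_restrict_of_ae (Measure.ae_ne volume p),
      ae_restrict_mem measurableSet_ball] with x hx hxball
    have hη : η x = 1 := η.one_of_mem_closedBall (Metric.ball_subset_closedBall hxball)
    rw [show -(Module.finrank ℝ E : ℝ) = -2 * α - 2 by rw [hα]; ring]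
    simp_rw [hη, one_pow, one_mul]
    exact ENNReal.tendsto_ofReal (tendsto_norm_gradient_regularizedPow_sq hε
      tendsto_one_div_add_atTop_nhds_zero_nat hx)
  have hfatou := lintegral_le_of_tendsto_ae (fun k =>
    (integrable_mul_norm_gradient_regularizedPow_sq η (hε k)).aemeasurable.ennreal_ofReal.restrict)
    hlim hle tendsto_const_nhds
  refine not_integrableOn_norm_sub_rpow_neg_finrank p η.rIn_pos ?_
  refine (integrable_const_mul_iff (c := α ^ 2) (IsUnit.mk0 _ (pow_ne_zero 2 hα0.ne')) _).1
    ⟨(by fun_prop : Measurable _).aestronglyMeasurable, ?_⟩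
  rw [hasFiniteIntegral_iff_ofReal (Eventually.of_forall fun x => by positivity)]
  exact hfatou.trans_lt ENNReal.ofReal_lt_top

lemma integral_norm_gradient_mul_regularizedPow_sq_le (η : ContDiffBump p) (hα : 0 ≤ α)
    (hε : 0 < ε) {θ : ℝ} (hθ : 0 < θ) :
    ∫ x, ‖∇ (fun y => η y * regularizedPow p α ε y) x‖ ^ 2 ≤
      (1 + θ) * (∫ x, η x ^ 2 * ‖∇ (regularizedPow p α ε) x‖ ^ 2) +
        (1 + θ⁻¹) * ((η.rIn ^ 2) ^ (-α) * ∫ x, ‖∇ η x‖ ^ 2) := by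
  have hpow : ContDiff ℝ 1 (regularizedPow p α ε) := contDiff_regularizedPow hε
  have hmain := (integrable_mul_norm_gradient_regularizedPow_sq (α := α) η hε).const_mul (1 + θ)
  have hbump : Integrable fun x => ‖∇ η x‖ ^ 2 :=
    integrable_norm_gradient_sq η.contDiff η.hasCompactSupport
  simp_rw [← integral_const_mul]
  rw [← integral_add hmain ((hbump.const_mul _).const_mul _)]
  refine integral_mono (integrable_norm_gradient_sq (η.contDiff.mul hpow)
    η.hasCompactSupport.mul_right) (hmain.add ((hbump.const_mul _).const_mul _)) fun x => ?_
  refine (norm_gradient_mul_sq_le (η.contDiff.differentiable one_ne_zero x)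
    (hpow.differentiable one_ne_zero x) hθ).trans ?_
  gcongr (1 + θ) * _ + (1 + θ⁻¹) * ?_
  exact regularizedPow_sq_mul_norm_gradient_bump_sq_le η hα hε x

lemma integral_mul_norm_gradient_regularizedPow_sq_le (hE : 2 < Module.finrank ℝ E)
    (η : ContDiffBump p) (hε : 0 < ε) :
    ∫ x, η x ^ 2 * ‖∇ (regularizedPow p α ε) x‖ ^ 2 ≤
      α ^ 2 * ∫ x, (‖x - p‖ ^ 2)⁻¹ * (η x * regularizedPow p α ε x) ^ 2 := by
  have : Nontrivial E := Module.nontrivial_of_finrank_pos (R := ℝ) (by omega)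
  have hcont : Continuous fun x => η x * regularizedPow p α ε x :=
    η.continuous.mul (contDiff_regularizedPow hε (m := 0)).continuous
  have hint : Integrable fun x => (‖x - p‖ ^ 2)⁻¹ * (η x * regularizedPow p α ε x) ^ 2 :=
    (locallyIntegrable_inv_norm_sub_sq hE p).integrable_smul_right_of_hasCompactSupport
      (hcont.pow 2) (hasCompactSupport_sq η.hasCompactSupport.mul_right)
  rw [← integral_const_mul]
  refine integral_mono_ae (integrable_mul_norm_gradient_regularizedPow_sq η hε)
    (hint.const_mul _) ?_
  filter_upwards [Measure.ae_ne volume p] with x hx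
  calc η x ^ 2 * ‖∇ (regularizedPow p α ε) x‖ ^ 2
      ≤ η x ^ 2 * (α ^ 2 * ((‖x - p‖ ^ 2)⁻¹ * regularizedPow p α ε x ^ 2)) := by
        gcongr
        exact norm_gradient_regularizedPow_sq_le hε hx
    _ = _ := by ring

lemma exists_integral_norm_gradient_sq_lt (hE : 2 < Module.finrank ℝ E) (p : E) {c ρ : ℝ}
    (hc : (((Module.finrank ℝ E : ℝ) - 2) / 2) ^ 2 < c) (hρ : 0 < ρ) :
    ∃ u : E → ℝ, ContDiff ℝ (⊤ : ℕ∞) u ∧ HasCompactSupport u ∧ tsupport u ⊆ Metric.ball p ρ ∧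
      ∫ x, ‖∇ u x‖ ^ 2 < c * ∫ x, (‖x - p‖ ^ 2)⁻¹ * u x ^ 2 := by
  have hE' : (2 : ℝ) < Module.finrank ℝ E := by exact_mod_cast hE
  set α : ℝ := ((Module.finrank ℝ E : ℝ) - 2) / 2 with hα
  have hα0 : 0 < α := by linarith
  let η : ContDiffBump p := ⟨ρ / 4, ρ / 2, by positivity, by linarith⟩
  set θ : ℝ := (c - α ^ 2) / (2 * α ^ 2) with hθ
  have hθ0 : 0 < θ := div_pos (by linarith) (by positivity)
  have hcθ : c = (1 + θ + θ) * α ^ 2 := by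
    rw [hθ]
    field_simp
    ring
  set K : ℝ := (1 + θ⁻¹) * ((η.rIn ^ 2) ^ (-α) * ∫ x, ‖∇ η x‖ ^ 2)
  obtain ⟨ε, hε, hblow⟩ := exists_lt_integral_mul_norm_gradient_regularizedPow_sq hE η (K / θ)
  rw [← hα, div_lt_iff₀' hθ0] at hblow
  refine ⟨fun x => η x * regularizedPow p α ε x, η.contDiff.mul (contDiff_regularizedPow hε),
    η.hasCompactSupport.mul_right, ?_, ?_⟩
  · refine (closure_mono (Function.support_mul_subset_left (η : E → ℝ) _)).trans ?_
    rw [← tsupport, η.tsupport_eq]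
    exact Metric.closedBall_subset_ball (half_lt_self hρ)
  · set I : ℝ := ∫ x, η x ^ 2 * ‖∇ (regularizedPow p α ε) x‖ ^ 2
    calc ∫ x, ‖∇ (fun x => η x * regularizedPow p α ε x) x‖ ^ 2 ≤ (1 + θ) * I + K :=
          integral_norm_gradient_mul_regularizedPow_sq_le η hα0.le hε hθ0
      _ < (1 + θ + θ) * I := by linarith
      _ ≤ (1 + θ + θ) * (α ^ 2 * ∫ x, (‖x - p‖ ^ 2)⁻¹ * (η x * regularizedPow p α ε x) ^ 2) := by
          gcongr
          exact integral_mul_norm_gradient_regularizedPow_sq_le hE η hε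
      _ = _ := by rw [hcθ, mul_assoc]

end Concentration

section TestFunction

variable {E : Type*} [NormedAddCommGroup E] [InnerProductSpace ℝ E] {Ω : Opens E}

lemma contDiff_one (φ : 𝓓(Ω, ℝ)) : ContDiff ℝ 1 (φ : E → ℝ) :=
  φ.contDiff.of_le (by exact_mod_cast le_top)

lemma testFunction_apply_eq_zero (φ : 𝓓(Ω, ℝ)) {x : E} (hx : x ∉ Ω) : φ x = 0 :=
  image_eq_zero_of_notMem_tsupport fun h => hx (φ.tsupport_subset h)

lemma setIntegral_mul_testFunction_sq [MeasurableSpace E] {μ : Measure E}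
    (φ : 𝓓(Ω, ℝ)) (W : E → ℝ) :
    ∫ x in Ω, W x * φ x ^ 2 ∂μ = ∫ x, W x * φ x ^ 2 ∂μ :=
  setIntegral_eq_integral_of_forall_compl_eq_zero fun x hx => by
    rw [testFunction_apply_eq_zero φ hx, zero_pow two_ne_zero, mul_zero]

lemma setIntegral_testFunction_sq [MeasurableSpace E] {μ : Measure E}
    (φ : 𝓓(Ω, ℝ)) :
    ∫ x in Ω, φ x ^ 2 ∂μ = ∫ x, φ x ^ 2 ∂μ := by
  simpa only [one_mul] using setIntegral_mul_testFunction_sq φ fun _ => 1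

variable [CompleteSpace E]

lemma gradient_testFunction_eq_zero (φ : 𝓓(Ω, ℝ)) {x : E} (hx : x ∉ Ω) :
    ∇ (φ : E → ℝ) x = 0 := by
  rw [gradient, fderiv_of_notMem_tsupport ℝ fun h => hx (φ.tsupport_subset h), map_zero]

lemma gradient_testFunction_smul (φ : 𝓓(Ω, ℝ)) (c : ℝ) (x : E) :
    ∇ ((c • φ : 𝓓(Ω, ℝ)) : E → ℝ) x = c • ∇ (φ : E → ℝ) x := by
  rw [show ((c • φ : 𝓓(Ω, ℝ)) : E → ℝ) = c • (φ : E → ℝ) from rfl, gradient,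
    fderiv_const_smul ((contDiff_one φ).differentiable one_ne_zero x), map_smul, gradient]

lemma gradient_testFunction_add (φ ψ : 𝓓(Ω, ℝ)) (x : E) :
    ∇ ((φ + ψ : 𝓓(Ω, ℝ)) : E → ℝ) x = ∇ (φ : E → ℝ) x + ∇ (ψ : E → ℝ) x := by
  rw [show ((φ + ψ : 𝓓(Ω, ℝ)) : E → ℝ) = (φ : E → ℝ) + (ψ : E → ℝ) from rfl, gradient,
    fderiv_add ((contDiff_one φ).differentiable one_ne_zero x)
      ((contDiff_one ψ).differentiable one_ne_zero x), map_add, gradient, gradient]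

lemma gradient_testFunction_sub (φ ψ : 𝓓(Ω, ℝ)) (x : E) :
    ∇ ((φ - ψ : 𝓓(Ω, ℝ)) : E → ℝ) x = ∇ (φ : E → ℝ) x - ∇ (ψ : E → ℝ) x := by
  rw [show ((φ - ψ : 𝓓(Ω, ℝ)) : E → ℝ) = (φ : E → ℝ) - (ψ : E → ℝ) from rfl, gradient,
    fderiv_sub ((contDiff_one φ).differentiable one_ne_zero x)
      ((contDiff_one ψ).differentiable one_ne_zero x), map_sub, gradient, gradient]

lemma setIntegral_norm_gradient_testFunction_sq [MeasurableSpace E] {μ : Measure E}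
    (φ : 𝓓(Ω, ℝ)) :
    ∫ x in Ω, ‖∇ (φ : E → ℝ) x‖ ^ 2 ∂μ = ∫ x, ‖∇ (φ : E → ℝ) x‖ ^ 2 ∂μ :=
  setIntegral_eq_integral_of_forall_compl_eq_zero fun x hx => by
    rw [gradient_testFunction_eq_zero φ hx, norm_zero, zero_pow two_ne_zero]

end TestFunction

section Sharpness

variable {N n : ℕ}

lemma inv_mul_sum_Ioi_le_potential (a : Fin n → EuclideanSpace ℝ (Fin N))
    (x : EuclideanSpace ℝ (Fin N)) (i : Fin n) :
    (‖x - a i‖ ^ 2)⁻¹ * ∑ j ∈ Finset.Ioi i, ‖a i - a j‖ ^ 2 / ‖x - a j‖ ^ 2 ≤ potential a x :=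
  calc (‖x - a i‖ ^ 2)⁻¹ * ∑ j ∈ Finset.Ioi i, ‖a i - a j‖ ^ 2 / ‖x - a j‖ ^ 2
      = ∑ j ∈ Finset.Ioi i, ‖a i - a j‖ ^ 2 / (‖x - a i‖ ^ 2 * ‖x - a j‖ ^ 2) := by
        rw [Finset.mul_sum]
        exact Finset.sum_congr rfl fun j _ => by rw [inv_mul_eq_div, div_div, mul_comm]
    _ ≤ potential a x := Finset.single_le_sum
        (f := fun i => ∑ j ∈ Finset.Ioi i, ‖a i - a j‖ ^ 2 / (‖x - a i‖ ^ 2 * ‖x - a j‖ ^ 2))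
        (fun _ _ => Finset.sum_nonneg fun _ _ => by positivity) (Finset.mem_univ i)

-- Near `a 0` the potential behaves like `(n - 1) / ‖x - a 0‖ ^ 2`, one unit for each other pole.
lemma eventually_mul_inv_le_mul_potential_sub [NeZero n] {a : Fin n → EuclideanSpace ℝ (Fin N)}
    (ha : Function.Injective a) {c μ : ℝ} (hμ : 0 ≤ μ) (hc : c < μ * (n - 1)) (lam : ℝ) :
    ∀ᶠ x in 𝓝 (a 0), x ≠ a 0 → c * (‖x - a 0‖ ^ 2)⁻¹ ≤ μ * potential a x - lam := by
  set S : EuclideanSpace ℝ (Fin N) → ℝ := fun x =>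
    ∑ j ∈ Finset.Ioi 0, ‖a 0 - a j‖ ^ 2 / ‖x - a j‖ ^ 2
  have hne : ∀ j ∈ Finset.Ioi (0 : Fin n), ‖a 0 - a j‖ ^ 2 ≠ 0 := fun j hj =>
    pow_ne_zero 2 (norm_ne_zero_iff.2 (sub_ne_zero.2 (ha.ne (Finset.mem_Ioi.1 hj).ne)))
  have hS : Tendsto S (𝓝 (a 0)) (𝓝 (n - 1)) := by
    have hS0 : S (a 0) = n - 1 := by
      simp only [S]
      rw [Finset.sum_congr rfl fun j hj => div_self (hne j hj)]
      simp [Nat.cast_sub NeZero.one_le]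
    rw [← hS0]
    exact tendsto_finsetSum _ fun j hj => ContinuousAt.div continuousAt_const (by fun_prop)
      (hne j hj)
  have hsq : Tendsto (fun x => lam * ‖x - a 0‖ ^ 2) (𝓝 (a 0)) (𝓝 0) := by
    have : Continuous fun x => lam * ‖x - a 0‖ ^ 2 := by fun_prop
    simpa using this.tendsto (a 0)
  have hlim := (hS.const_mul μ).sub hsq
  rw [sub_zero] at hlim
  filter_upwards [hlim.eventually_const_lt hc] with x hx hxa
  have hr : 0 < ‖x - a 0‖ ^ 2 := pow_pos (norm_pos_iff.2 (sub_ne_zero.2 hxa)) 2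
  calc c * (‖x - a 0‖ ^ 2)⁻¹ ≤ (μ * S x - lam * ‖x - a 0‖ ^ 2) * (‖x - a 0‖ ^ 2)⁻¹ := by gcongr
    _ = μ * ((‖x - a 0‖ ^ 2)⁻¹ * S x) - lam := by
        rw [sub_mul, mul_assoc lam, mul_inv_cancel₀ hr.ne']
        ring
    _ ≤ μ * potential a x - lam := by
        gcongr
        exact inv_mul_sum_Ioi_le_potential a x 0

lemma exists_testFunction_lt_mul_potential (hN : 3 ≤ N) (hn : 2 ≤ n)
    {Ω : Opens (EuclideanSpace ℝ (Fin N))} {a : Fin n → EuclideanSpace ℝ (Fin N)}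
    (ha : Function.Injective a) (haΩ : ∀ i, a i ∈ Ω) {μ : ℝ}
    (hμ : ((N : ℝ) - 2) ^ 2 / (4 * n - 4) < μ) (lam : ℝ) : ∃ u : 𝓓(Ω, ℝ),
      lam * (∫ x, u x ^ 2) + (∫ x, ‖∇ (u : EuclideanSpace ℝ (Fin N) → ℝ) x‖ ^ 2) <
        μ * ∫ x, potential a x * u x ^ 2 := by
  have : NeZero n := ⟨by omega⟩
  have hn' : (2 : ℝ) ≤ n := by exact_mod_cast hn
  have hE := two_lt_finrank_euclideanSpace hN
  have hμ0 : 0 ≤ μ := (div_nonneg (sq_nonneg _) (by linarith)).trans hμ.le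
  obtain ⟨c, hc, hcμ⟩ : ∃ c, (((N : ℝ) - 2) / 2) ^ 2 < c ∧ c < μ * (n - 1) := by
    rw [div_lt_iff₀ (by linarith)] at hμ
    exact exists_between (by linarith)
  obtain ⟨ρ, hρ, hball⟩ := Metric.eventually_nhds_iff_ball.1
    (Filter.Eventually.and (Ω.isOpen.mem_nhds (haΩ 0))
      (eventually_mul_inv_le_mul_potential_sub ha hμ0 hcμ lam))
  obtain ⟨u, hu, hu', hsupp, hlt⟩ := exists_integral_norm_gradient_sq_lt hE (a 0)
    (by rwa [finrank_euclideanSpace_fin]) hρ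
  refine ⟨⟨u, hu, hu', fun x hx => (hball x (hsupp hx)).1⟩, ?_⟩
  change lam * (∫ x, u x ^ 2) + (∫ x, ‖∇ u x‖ ^ 2) < μ * ∫ x, potential a x * u x ^ 2
  have hV := (integrable_potential_mul_sq hN a hu.continuous hu').const_mul μ
  have hsq : Integrable fun x => lam * u x ^ 2 :=
    ((hu.continuous.pow 2).integrable_of_hasCompactSupport (hasCompactSupport_sq hu')).const_mul _
  have hpole : Integrable fun x => (‖x - a 0‖ ^ 2)⁻¹ * u x ^ 2 :=
    (locallyIntegrable_inv_norm_sub_sq hE (a 0)).integrable_smul_right_of_hasCompactSupport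
      (hu.continuous.pow 2) (hasCompactSupport_sq hu')
  have hle : c * (∫ x, (‖x - a 0‖ ^ 2)⁻¹ * u x ^ 2) ≤
      μ * (∫ x, potential a x * u x ^ 2) - lam * ∫ x, u x ^ 2 := by
    simp_rw [← integral_const_mul]
    rw [← integral_sub hV hsq]
    refine integral_mono_ae (hpole.const_mul c) (hV.sub hsq) ?_
    filter_upwards [ae_forall_ne hN a] with x hx
    by_cases hux : u x = 0
    · simp [hux]
    have hbound := (hball x (hsupp (subset_tsupport _ hux))).2 (hx 0)
    calc c * ((‖x - a 0‖ ^ 2)⁻¹ * u x ^ 2) = c * (‖x - a 0‖ ^ 2)⁻¹ * u x ^ 2 := by ring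
      _ ≤ (μ * potential a x - lam) * u x ^ 2 := by gcongr
      _ = _ := by ring
  linarith

end Sharpness

section SquareIntegrable

variable {X F : Type*} [MeasurableSpace X] {μ : Measure X} [NormedAddCommGroup F]

lemma eLpNorm_two_sq (f : X → F) : eLpNorm f 2 μ ^ 2 = ∫⁻ x, ‖f x‖ₑ ^ 2 ∂μ := by
  simpa using eLpNorm_nnreal_pow_eq_lintegral (f := f) (μ := μ) (p := 2) two_ne_zero

lemma eLpNorm_two_integral_le [NormedSpace ℝ F] [SFinite μ] {T : Type*} [MeasurableSpace T]
    {ν : Measure T} [IsProbabilityMeasure ν] {k : X → T → F}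
    (hk : AEStronglyMeasurable k.uncurry (μ.prod ν)) {C : ℝ≥0∞}
    (hC : ∀ᵐ t ∂ν, eLpNorm (fun x => k x t) 2 μ ≤ C) :
    eLpNorm (fun x => ∫ t, k x t ∂ν) 2 μ ≤ C := by
  have hjensen : ∀ᵐ x ∂μ, ‖∫ t, k x t ∂ν‖ₑ ^ 2 ≤ ∫⁻ t, ‖k x t‖ₑ ^ 2 ∂ν := by
    filter_upwards [hk.prodMk_left] with x hx
    rw [← eLpNorm_two_sq]
    gcongr
    refine (enorm_integral_le_lintegral_enorm _).trans ?_
    rw [← eLpNorm_one_eq_lintegral_enorm]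
    exact eLpNorm_le_eLpNorm_of_exponent_le one_le_two hx
  refine (ENNReal.pow_le_pow_left_iff two_ne_zero).1 ?_
  calc eLpNorm (fun x => ∫ t, k x t ∂ν) 2 μ ^ 2 = ∫⁻ x, ‖∫ t, k x t ∂ν‖ₑ ^ 2 ∂μ :=
        eLpNorm_two_sq _
    _ ≤ ∫⁻ x, ∫⁻ t, ‖k x t‖ₑ ^ 2 ∂ν ∂μ := lintegral_mono_ae hjensen
    _ = ∫⁻ t, eLpNorm (fun x => k x t) 2 μ ^ 2 ∂ν := by
        simp_rw [eLpNorm_two_sq]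
        exact lintegral_lintegral_swap (hk.enorm.pow_const 2)
    _ ≤ ∫⁻ _, C ^ 2 ∂ν := lintegral_mono_ae (by filter_upwards [hC] with t ht; gcongr)
    _ = C ^ 2 := by rw [lintegral_const, measure_univ, mul_one]

lemma tendsto_eLpNorm_two_of_ae_bound [IsFiniteMeasure μ] {ι : Type*} {l : Filter ι}
    [l.IsCountablyGenerated] {f : ι → X → F} (hf : ∀ i, AEStronglyMeasurable (f i) μ) {K : ℝ≥0∞}
    (hK : K ≠ ∞) (hbound : ∀ i, ∀ᵐ x ∂μ, ‖f i x‖ₑ ≤ K)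
    (hlim : ∀ᵐ x ∂μ, Tendsto (fun i => f i x) l (𝓝 0)) :
    Tendsto (fun i => eLpNorm (f i) 2 μ) l (𝓝 0) := by
  have hsq : Tendsto (fun i => ∫⁻ x, ‖f i x‖ₑ ^ 2 ∂μ) l (𝓝 (∫⁻ _, 0 ∂μ)) := by
    refine tendsto_lintegral_filter_of_dominated_convergence' (fun _ => K ^ 2)
      (Eventually.of_forall fun i => (hf i).enorm.pow_const 2) (Eventually.of_forall fun i => ?_)
      ?_ ?_
    · filter_upwards [hbound i] with x hx
      gcongr
    · rw [lintegral_const]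
      exact ENNReal.mul_ne_top (ENNReal.pow_ne_top hK) (measure_ne_top μ _)
    · filter_upwards [hlim] with x hx
      simpa using ENNReal.Tendsto.pow (n := 2) hx.enorm
  simp_rw [← eLpNorm_two_sq, lintegral_zero] at hsq
  simpa [← ENNReal.rpow_natCast_mul] using hsq.ennrpow_const 2⁻¹

end SquareIntegrable

lemma exists_subseq_tendsto_inner {H : Type*} [NormedAddCommGroup H] [InnerProductSpace ℝ H]
    [CompleteSpace H] [SeparableSpace H] {v : ℕ → H} {C : ℝ} (hv : ∀ k, ‖v k‖ ≤ C) :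
    ∃ σ : ℕ → ℕ, StrictMono σ ∧ ∃ w, ∀ y,
      Tendsto (fun k => inner ℝ (v (σ k)) y) atTop (𝓝 (inner ℝ w y)) := by
  obtain ⟨ℓ, -, σ, hσ, hlim⟩ := WeakDual.isSeqCompact_closedBall ℝ H 0 C
    (x := fun k => StrongDual.toWeakDual (InnerProductSpace.toDual ℝ H (v k)))
    fun k => by simpa using hv k
  refine ⟨σ, hσ, (InnerProductSpace.toDual ℝ H).symm (WeakDual.toStrongDual ℓ), fun y => ?_⟩
  rw [InnerProductSpace.toDual_symm_apply]
  exact ((WeakDual.eval_continuous y).tendsto ℓ).comp hlim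

lemma exists_subseq_tendsto_setIntegral {X : Type*} [MeasurableSpace X] {μ : Measure X}
    [SigmaFinite μ] [MeasurableSpace.CountablyGenerated X] {u : ℕ → X → ℝ}
    (hu : ∀ k, MemLp (u k) 2 μ) {C : ℝ≥0∞} (hC : C ≠ ∞) (huC : ∀ k, eLpNorm (u k) 2 μ ≤ C) :
    ∃ σ : ℕ → ℕ, StrictMono σ ∧ ∀ {s : Set X}, MeasurableSet s → μ s ≠ ∞ →
      ∃ c, Tendsto (fun k => ∫ x in s, u (σ k) x ∂μ) atTop (𝓝 c) := by
  have : Fact ((2 : ℝ≥0∞) ≠ ∞) := ⟨ENNReal.ofNat_ne_top⟩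
  obtain ⟨σ, hσ, w, hw⟩ := exists_subseq_tendsto_inner (v := fun k => (hu k).toLp (u k))
    (C := C.toReal) fun k => by
      rw [Lp.norm_toLp]
      exact ENNReal.toReal_mono hC (huC k)
  refine ⟨σ, hσ, fun {s} hs hμs => ⟨inner ℝ w (indicatorConstLp 2 hs hμs (1 : ℝ)), ?_⟩⟩
  refine (hw _).congr fun k => ?_
  rw [real_inner_comm, L2.inner_indicatorConstLp_one]
  exact setIntegral_congr_ae hs ((hu (σ k)).coeFn_toLp.mono fun x hx _ => hx)

section Rellich

variable {E F : Type*} [NormedAddCommGroup E] [NormedSpace ℝ E] [FiniteDimensional ℝ E]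
  [MeasurableSpace E] [BorelSpace E] {μ : Measure E} [μ.IsAddHaarMeasure]
  [NormedAddCommGroup F] [NormedSpace ℝ F]

lemma eLpNorm_two_comp_add_sub_le [CompleteSpace F] {u : E → F} (hu : ContDiff ℝ 1 u) (h : E) :
    eLpNorm (fun x => u (x + h) - u x) 2 μ ≤ ‖h‖ₑ * eLpNorm (fderiv ℝ u) 2 μ := by
  have hcont : Continuous (fderiv ℝ u) := hu.continuous_fderiv one_ne_zero
  have : IsProbabilityMeasure (volume.restrict (Set.Ioc (0 : ℝ) 1)) := ⟨by simp⟩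
  have hftc (x : E) : u (x + h) - u x = ∫ t in Set.Ioc (0 : ℝ) 1, fderiv ℝ u (x + t • h) h := by
    rw [← intervalIntegral.integral_of_le zero_le_one,
      intervalIntegral.integral_eq_sub_of_hasDerivAt (f := fun t : ℝ => u (x + t • h))]
    · simp
    · intro t _
      have hline : HasDerivAt (fun t : ℝ => x + t • h) h t := by
        simpa using ((hasDerivAt_id t).smul_const h).const_add x
      exact ((hu.differentiable one_ne_zero _).hasFDerivAt).comp_hasDerivAt t hline
    · exact Continuous.intervalIntegrable (by fun_prop) 0 1
  simp_rw [hftc]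
  refine eLpNorm_two_integral_le (Continuous.aestronglyMeasurable
    (f := fun q : E × ℝ => fderiv ℝ u (q.1 + q.2 • h) h) (by fun_prop)) (ae_of_all _ fun t => ?_)
  calc eLpNorm (fun x => fderiv ℝ u (x + t • h) h) 2 μ
      ≤ ‖h‖ₑ * eLpNorm (fun x => fderiv ℝ u (x + t • h)) 2 μ := by
        refine eLpNorm_le_nnreal_smul_eLpNorm_of_ae_le_mul (ae_of_all _ fun x => ?_) 2
        rw [mul_comm]
        exact ContinuousLinearMap.le_opNNNorm _ h
    _ = ‖h‖ₑ * eLpNorm (fderiv ℝ u) 2 μ := by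
        rw [← eLpNorm_comp_measurePreserving hcont.aestronglyMeasurable
          (measurePreserving_add_right μ (t • h))]
        rfl

omit [NormedSpace ℝ E] [FiniteDimensional ℝ E] in
lemma average_ball_eq_integral_cond (u : E → F) (x : E) (r : ℝ) :
    ⨍ y in Metric.ball x r, u y ∂μ =
      ∫ h, u (x + h) ∂(ProbabilityTheory.cond μ (Metric.ball 0 r)) := by
  rw [setAverage_eq, Measure.addHaar_real_ball_center, measureReal_def, ← ENNReal.toReal_inv,
    ProbabilityTheory.cond, integral_smul_measure,
    ← (measurePreserving_add_left μ x).setIntegral_preimage_emb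
      (Homeomorph.addLeft x).measurableEmbedding, preimage_add_ball, sub_self]

omit [BorelSpace E] in
lemma isProbabilityMeasure_cond_ball {r : ℝ} (hr : 0 < r) :
    IsProbabilityMeasure (ProbabilityTheory.cond μ (Metric.ball 0 r)) :=
  ProbabilityTheory.cond_isProbabilityMeasure_of_finite
    (Metric.measure_ball_pos μ 0 hr).ne' measure_ball_lt_top.ne

omit [NormedSpace ℝ F] in
lemma integrable_comp_add_cond_ball {u : E → F} (hu : Continuous u) (x : E) {r : ℝ} (hr : 0 < r) :
    Integrable (fun h => u (x + h)) (ProbabilityTheory.cond μ (Metric.ball 0 r)) :=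
  (((hu.comp (continuous_const_add x)).continuousOn.integrableOn_compact
    (isCompact_closedBall 0 r)).mono_set Metric.ball_subset_closedBall).smul_measure
    (ENNReal.inv_ne_top.2 (Metric.measure_ball_pos μ 0 hr).ne')

lemma eLpNorm_two_average_sub_le [CompleteSpace F] {u : E → F} (hu : ContDiff ℝ 1 u) {r : ℝ}
    (hr : 0 < r) :
    eLpNorm (fun x => (⨍ y in Metric.ball x r, u y ∂μ) - u x) 2 μ ≤
      ENNReal.ofReal r * eLpNorm (fderiv ℝ u) 2 μ := by
  set ν : Measure E := ProbabilityTheory.cond μ (Metric.ball 0 r)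
  have : IsProbabilityMeasure ν := isProbabilityMeasure_cond_ball hr
  have hcont : Continuous u := hu.continuous
  have havg (x : E) : (⨍ y in Metric.ball x r, u y ∂μ) - u x = ∫ h, u (x + h) - u x ∂ν := by
    rw [integral_sub (integrable_comp_add_cond_ball hcont x hr) (integrable_const _),
      integral_const, probReal_univ, one_smul, average_ball_eq_integral_cond]
  simp_rw [havg]
  refine eLpNorm_two_integral_le (Continuous.aestronglyMeasurable
    (f := fun q : E × E => u (q.1 + q.2) - u q.1) (by fun_prop)) ?_
  filter_upwards [ProbabilityTheory.ae_cond_mem measurableSet_ball] with h hh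
  refine (eLpNorm_two_comp_add_sub_le hu h).trans ?_
  gcongr
  rw [← ofReal_norm]
  exact ENNReal.ofReal_le_ofReal (mem_ball_zero_iff.1 hh).le

lemma enorm_average_ball_le {u : E → F} (hu : AEStronglyMeasurable u μ) (x : E) {r : ℝ}
    (hr : 0 < r) :
    ‖⨍ y in Metric.ball x r, u y ∂μ‖ₑ ≤ (μ (Metric.ball 0 r))⁻¹ ^ (1 / 2 : ℝ) * eLpNorm u 2 μ := by
  have : IsProbabilityMeasure (ProbabilityTheory.cond μ (Metric.ball 0 r)) :=
    isProbabilityMeasure_cond_ball hr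
  have hshift : MeasurePreserving (fun h => x + h) μ μ := measurePreserving_add_left μ x
  have hmeas : AEStronglyMeasurable (fun h => u (x + h)) μ := hu.comp_measurePreserving hshift
  rw [average_ball_eq_integral_cond]
  calc ‖∫ h, u (x + h) ∂(ProbabilityTheory.cond μ (Metric.ball 0 r))‖ₑ
      ≤ eLpNorm (fun h => u (x + h)) 1 (ProbabilityTheory.cond μ (Metric.ball 0 r)) := by
        rw [eLpNorm_one_eq_lintegral_enorm]
        exact enorm_integral_le_lintegral_enorm _
    _ ≤ eLpNorm (fun h => u (x + h)) 2 (ProbabilityTheory.cond μ (Metric.ball 0 r)) :=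
        eLpNorm_le_eLpNorm_of_exponent_le one_le_two
          (hmeas.mono_ac ProbabilityTheory.cond_absolutelyContinuous)
    _ = (μ (Metric.ball 0 r))⁻¹ ^ (1 / 2 : ℝ) *
          eLpNorm (fun h => u (x + h)) 2 (μ.restrict (Metric.ball 0 r)) := by
        simp [ProbabilityTheory.cond, eLpNorm_smul_measure_of_ne_top]
    _ ≤ (μ (Metric.ball 0 r))⁻¹ ^ (1 / 2 : ℝ) * eLpNorm u 2 μ := by
        rw [← eLpNorm_comp_measurePreserving hu hshift]
        gcongr
        exact eLpNorm_mono_measure _ Measure.restrict_le_self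

lemma stronglyMeasurable_average_ball {u : E → F} (hu : Continuous u) {r : ℝ} (hr : 0 < r) :
    StronglyMeasurable fun x => ⨍ y in Metric.ball x r, u y ∂μ := by
  have : IsProbabilityMeasure (ProbabilityTheory.cond μ (Metric.ball 0 r)) :=
    isProbabilityMeasure_cond_ball hr
  simp_rw [average_ball_eq_integral_cond]
  exact StronglyMeasurable.integral_prod_right
    (f := fun x h => u (x + h)) (Continuous.stronglyMeasurable (by fun_prop))

variable {ι : Type*} {l : Filter ι} [l.IsCountablyGenerated] {w : ι → E → F} {s : Set E}
  {C : ℝ≥0∞}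

lemma tendsto_eLpNorm_two_average (hw : ∀ i, Continuous (w i)) (hs : μ s ≠ ∞) (hC : C ≠ ∞)
    (hwC : ∀ i, eLpNorm (w i) 2 μ ≤ C) {r : ℝ} (hr : 0 < r)
    (hlim : ∀ x, Tendsto (fun i => ∫ y in Metric.ball x r, w i y ∂μ) l (𝓝 0)) :
    Tendsto (fun i => eLpNorm (fun x => ⨍ y in Metric.ball x r, w i y ∂μ) 2 (μ.restrict s)) l
      (𝓝 0) := by
  have : IsFiniteMeasure (μ.restrict s) := isFiniteMeasure_restrict.2 hs
  refine tendsto_eLpNorm_two_of_ae_bound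
    (fun i => (stronglyMeasurable_average_ball (hw i) hr).aestronglyMeasurable)
    (K := (μ (Metric.ball 0 r))⁻¹ ^ (1 / 2 : ℝ) * C) ?_ (fun i => ae_of_all _ fun x => ?_)
    (ae_of_all _ fun x => ?_)
  · exact ENNReal.mul_ne_top (ENNReal.rpow_ne_top_of_nonneg (by norm_num)
      (ENNReal.inv_ne_top.2 (Metric.measure_ball_pos μ 0 hr).ne')) hC
  · exact (enorm_average_ball_le (hw i).aestronglyMeasurable x hr).trans
      (by gcongr; exact hwC i)
  · simp_rw [setAverage_eq]
    simpa using (hlim x).const_smul (μ.real (Metric.ball x r))⁻¹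

-- The gradient bound makes `w i` uniformly close to its ball averages, and these converge
-- pointwise under a uniform bound.
theorem tendsto_eLpNorm_two_of_tendsto_setIntegral_ball [CompleteSpace F]
    (hw : ∀ i, ContDiff ℝ 1 (w i)) (hs : μ s ≠ ∞) (hws : ∀ i, Function.support (w i) ⊆ s)
    (hC : C ≠ ∞) (hwC : ∀ i, eLpNorm (w i) 2 μ ≤ C)
    (hwC' : ∀ i, eLpNorm (fderiv ℝ (w i)) 2 μ ≤ C)
    (hlim : ∀ x r, Tendsto (fun i => ∫ y in Metric.ball x r, w i y ∂μ) l (𝓝 0)) :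
    Tendsto (fun i => eLpNorm (w i) 2 μ) l (𝓝 0) := by
  refine ENNReal.tendsto_nhds_zero.2 fun ε hε => ?_
  obtain ⟨r, hr, hrε⟩ : ∃ r : ℝ, 0 < r ∧ ENNReal.ofReal r * C ≤ ε / 2 := by
    obtain ⟨r, hr, hrε⟩ := ENNReal.exists_nnreal_pos_mul_lt hC (ENNReal.half_pos hε.ne').ne'
    exact ⟨r, NNReal.coe_pos.2 hr, by simpa using hrε.le⟩
  filter_upwards [ENNReal.tendsto_nhds_zero.1 (tendsto_eLpNorm_two_average
    (fun i => (hw i).continuous) hs hC hwC hr fun x => hlim x r) (ε / 2)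
    (ENNReal.half_pos hε.ne')] with i hi
  set A : E → F := fun x => ⨍ y in Metric.ball x r, w i y ∂μ
  have hA : AEStronglyMeasurable A μ :=
    (stronglyMeasurable_average_ball (hw i).continuous hr).aestronglyMeasurable
  have hwi : AEStronglyMeasurable (w i) μ := (hw i).continuous.aestronglyMeasurable
  calc eLpNorm (w i) 2 μ = eLpNorm (A - (A - w i)) 2 (μ.restrict s) := by
        rw [sub_sub_cancel, eLpNorm_restrict_eq_of_support_subset (hws i)]
    _ ≤ eLpNorm A 2 (μ.restrict s) + eLpNorm (A - w i) 2 (μ.restrict s) :=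
        eLpNorm_sub_le hA.restrict (hA.sub hwi).restrict one_le_two
    _ ≤ ε / 2 + ENNReal.ofReal r * C := by
        gcongr
        exact (eLpNorm_mono_measure _ Measure.restrict_le_self).trans
          ((eLpNorm_two_average_sub_le (hw i) hr).trans (by gcongr; exact hwC' i))
    _ ≤ ε := by
        grw [hrε, ENNReal.add_halves]

theorem exists_subseq_tendsto_eLpNorm_two_sub {u : ℕ → E → ℝ} (hu : ∀ k, ContDiff ℝ 1 (u k))
    {s : Set E} (hs : Bornology.IsBounded s) (hus : ∀ k, Function.support (u k) ⊆ s) {C : ℝ≥0∞}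
    (hC : C ≠ ∞) (huC : ∀ k, eLpNorm (u k) 2 μ ≤ C)
    (huC' : ∀ k, eLpNorm (fderiv ℝ (u k)) 2 μ ≤ C) :
    ∃ σ : ℕ → ℕ, StrictMono σ ∧
      Tendsto (fun q : ℕ × ℕ => eLpNorm (u (σ q.1) - u (σ q.2)) 2 μ) atTop (𝓝 0) := by
  obtain ⟨σ, hσ, hlim⟩ := exists_subseq_tendsto_setIntegral
    (fun k => ⟨(hu k).continuous.aestronglyMeasurable, (huC k).trans_lt hC.lt_top⟩) hC huC
  refine ⟨σ, hσ, ?_⟩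
  have hfderiv (k : ℕ) : AEStronglyMeasurable (fderiv ℝ (u k)) μ :=
    ((hu k).continuous_fderiv one_ne_zero).aestronglyMeasurable
  have hint (k : ℕ) (x : E) (r : ℝ) : IntegrableOn (u k) (Metric.ball x r) μ :=
    ((hu k).continuous.continuousOn.integrableOn_compact
      (isCompact_closedBall x r)).mono_set Metric.ball_subset_closedBall
  have hsub (q : ℕ × ℕ) :
      fderiv ℝ (u (σ q.1) - u (σ q.2)) = fderiv ℝ (u (σ q.1)) - fderiv ℝ (u (σ q.2)) :=
    funext fun x => fderiv_sub ((hu _).differentiable one_ne_zero x)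
      ((hu _).differentiable one_ne_zero x)
  refine tendsto_eLpNorm_two_of_tendsto_setIntegral_ball (s := s) (C := C + C)
    (fun q => (hu _).sub (hu _)) hs.measure_lt_top.ne
    (fun q => (Function.support_sub _ _).trans (Set.union_subset (hus _) (hus _)))
    (ENNReal.add_ne_top.2 ⟨hC, hC⟩) (fun q => ?_) (fun q => ?_) fun x r => ?_
  · exact (eLpNorm_sub_le (hu _).continuous.aestronglyMeasurable
      (hu _).continuous.aestronglyMeasurable one_le_two).trans (add_le_add (huC _) (huC _))
  · rw [hsub]
    exact (eLpNorm_sub_le (hfderiv _) (hfderiv _) one_le_two).trans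
      (add_le_add (huC' _) (huC' _))
  · obtain ⟨c, hc⟩ := hlim measurableSet_ball (measure_ball_lt_top (x := x) (r := r)).ne
    simp_rw [Pi.sub_apply, integral_sub (hint _ x r) (hint _ x r), ← prod_atTop_atTop_eq]
    rw [← sub_self c]
    exact (hc.comp tendsto_fst).sub (hc.comp tendsto_snd)

end Rellich

section LpLimit

variable {X F : Type*} [MeasurableSpace X] {μ : Measure X} [NormedAddCommGroup F]

lemma lintegral_ofReal_norm_sq (f : X → F) :
    ∫⁻ x, ENNReal.ofReal (‖f x‖ ^ 2) ∂μ = eLpNorm f 2 μ ^ 2 := by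
  simp only [eLpNorm_two_sq, ENNReal.ofReal_pow (norm_nonneg _), ofReal_norm]

lemma eLpNorm_two_sq_eq_ofReal_integral {f : X → F} (hf : MemLp f 2 μ) :
    eLpNorm f 2 μ ^ 2 = ENNReal.ofReal (∫ x, ‖f x‖ ^ 2 ∂μ) := by
  rw [← lintegral_ofReal_norm_sq, ofReal_integral_eq_lintegral_ofReal
    (hf.integrable_norm_pow two_ne_zero) (Eventually.of_forall fun x => sq_nonneg _)]

lemma eLpNorm_two_eq_ofReal_sqrt_integral {f : X → F} (hf : MemLp f 2 μ) :
    eLpNorm f 2 μ = ENNReal.ofReal √(∫ x, ‖f x‖ ^ 2 ∂μ) := by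
  refine (ENNReal.pow_right_strictMono two_ne_zero).injective ?_
  rw [eLpNorm_two_sq_eq_ofReal_integral hf, ← ENNReal.ofReal_pow (Real.sqrt_nonneg _),
    Real.sq_sqrt (integral_nonneg fun x => sq_nonneg _)]

lemma tendsto_eLpNorm_two_zero_iff {ι : Type*} {l : Filter ι} {f : ι → X → F}
    (hf : ∀ i, MemLp (f i) 2 μ) :
    Tendsto (fun i => eLpNorm (f i) 2 μ) l (𝓝 0) ↔
      Tendsto (fun i => ∫ x, ‖f i x‖ ^ 2 ∂μ) l (𝓝 0) := by
  refine ⟨fun h => ?_, fun h => ?_⟩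
  · have hsq := ((ENNReal.tendsto_toReal ENNReal.zero_ne_top).comp h).pow 2
    have hnonneg (i : ι) : 0 ≤ ∫ x, ‖f i x‖ ^ 2 ∂μ := integral_nonneg fun x => sq_nonneg _
    simpa [Function.comp_def, eLpNorm_two_eq_ofReal_sqrt_integral (hf _), hnonneg] using hsq
  · simpa [eLpNorm_two_eq_ofReal_sqrt_integral (hf _)] using ENNReal.tendsto_ofReal h.sqrt

lemma integral_norm_sq_parallelogram {H : Type*} [NormedAddCommGroup H] [InnerProductSpace ℝ H]
    {f g : X → H} (hf : MemLp f 2 μ) (hg : MemLp g 2 μ) :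
    (∫ x, ‖f x + g x‖ ^ 2 ∂μ) + ∫ x, ‖f x - g x‖ ^ 2 ∂μ =
      2 * (∫ x, ‖f x‖ ^ 2 ∂μ) + 2 * ∫ x, ‖g x‖ ^ 2 ∂μ := by
  have hf' := (hf.integrable_norm_pow two_ne_zero).const_mul 2
  have hg' := (hg.integrable_norm_pow two_ne_zero).const_mul 2
  have hadd : Integrable (fun x => ‖f x + g x‖ ^ 2) μ :=
    (hf.add hg).integrable_norm_pow two_ne_zero
  have hsub : Integrable (fun x => ‖f x - g x‖ ^ 2) μ :=
    (hf.sub hg).integrable_norm_pow two_ne_zero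
  rw [← integral_add hadd hsub, ← integral_const_mul, ← integral_const_mul, ← integral_add hf' hg']
  refine integral_congr_ae (Eventually.of_forall fun x => ?_)
  linarith [parallelogram_law_with_norm ℝ (f x) (g x)]

lemma tendsto_eLpNorm_of_tendsto_eLpNorm_sub {p : ℝ≥0∞} [Fact (1 ≤ p)] {f : ℕ → X → F} {g : X → F}
    (hf : ∀ k, MemLp (f k) p μ) (hg : MemLp g p μ)
    (h : Tendsto (fun k => eLpNorm (f k - g) p μ) atTop (𝓝 0)) :
    Tendsto (fun k => eLpNorm (f k) p μ) atTop (𝓝 (eLpNorm g p μ)) := by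
  simpa only [Lp.enorm_toLp] using ((Lp.tendsto_Lp_iff_tendsto_eLpNorm'' f hf g hg).2 h).enorm

lemma exists_tendsto_eLpNorm_sub [CompleteSpace F] {p : ℝ≥0∞} [Fact (1 ≤ p)] {f : ℕ → X → F}
    (hf : ∀ k, MemLp (f k) p μ)
    (h : Tendsto (fun q : ℕ × ℕ => eLpNorm (f q.1 - f q.2) p μ) atTop (𝓝 0)) :
    ∃ g, MemLp g p μ ∧ Tendsto (fun k => eLpNorm (f k - g) p μ) atTop (𝓝 0) := by
  have hcauchy : CauchySeq fun k => (hf k).toLp (f k) := by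
    rw [Lp.cauchySeq_Lp_iff_cauchySeq_eLpNorm]
    exact h.congr fun q => eLpNorm_congr_ae ((hf _).coeFn_toLp.symm.sub (hf _).coeFn_toLp.symm)
  obtain ⟨g, hg⟩ := cauchySeq_tendsto_of_complete hcauchy
  rw [← Lp.toLp_coeFn g (Lp.memLp g), Lp.tendsto_Lp_iff_tendsto_eLpNorm''] at hg
  exact ⟨g, Lp.memLp g, hg⟩

lemma exists_tendsto_eLpNorm_two_sub [CompleteSpace F] {f : ℕ → X → F}
    (hf : ∀ k, MemLp (f k) 2 μ)
    (hcauchy : Tendsto (fun q : ℕ × ℕ => ∫ x, ‖f q.1 x - f q.2 x‖ ^ 2 ∂μ) atTop (𝓝 0)) {m : ℝ}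
    (hm : Tendsto (fun k => ∫ x, ‖f k x‖ ^ 2 ∂μ) atTop (𝓝 m)) :
    ∃ g, MemLp g 2 μ ∧ Tendsto (fun k => eLpNorm (f k - g) 2 μ) atTop (𝓝 0) ∧
      ∫⁻ x, ENNReal.ofReal (‖g x‖ ^ 2) ∂μ = ENNReal.ofReal m := by
  obtain ⟨g, hg, hlim⟩ := exists_tendsto_eLpNorm_sub hf
    ((tendsto_eLpNorm_two_zero_iff (f := fun q : ℕ × ℕ => f q.1 - f q.2)
      fun q => (hf q.1).sub (hf q.2)).2 hcauchy)
  have hnorm := ENNReal.Tendsto.pow (n := 2) (tendsto_eLpNorm_of_tendsto_eLpNorm_sub hf hg hlim)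
  simp_rw [eLpNorm_two_sq_eq_ofReal_integral (hf _)] at hnorm
  refine ⟨g, hg, hlim, ?_⟩
  rw [lintegral_ofReal_norm_sq]
  exact tendsto_nhds_unique hnorm (ENNReal.tendsto_ofReal hm)

lemma ae_eq_mul_of_tendsto_eLpNorm {p q : ℝ≥0∞} (hp : p ≠ 0) (hq : q ≠ 0) {f : ℕ → X → ℝ}
    {h u w : X → ℝ} (hf : ∀ k, AEStronglyMeasurable (f k) μ) (hh : AEStronglyMeasurable h μ)
    (hu : AEStronglyMeasurable u μ) (hw : AEStronglyMeasurable w μ)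
    (hfu : Tendsto (fun k => eLpNorm (f k - u) p μ) atTop (𝓝 0))
    (hfw : Tendsto (fun k => eLpNorm (h * f k - w) q μ) atTop (𝓝 0)) : w =ᵐ[μ] h * u := by
  obtain ⟨σ, hσ, hσu⟩ := (tendstoInMeasure_of_tendsto_eLpNorm hp hf hu hfu).exists_seq_tendsto_ae
  obtain ⟨τ, hτ, hτw⟩ := (tendstoInMeasure_of_tendsto_eLpNorm hq (fun k => hh.mul (hf (σ k))) hw
    (hfw.comp hσ.tendsto_atTop)).exists_seq_tendsto_ae
  filter_upwards [hσu, hτw] with x hxu hxw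
  exact tendsto_nhds_unique hxw ((hxu.comp hτ.tendsto_atTop).const_mul (h x))

end LpLimit

section TestFunctionRellich

variable {E : Type*} [NormedAddCommGroup E] [InnerProductSpace ℝ E] [MeasurableSpace E]
  [BorelSpace E] {μ : Measure E} {Ω : Opens E}

lemma memLp_testFunction [IsFiniteMeasureOnCompacts μ] (φ : 𝓓(Ω, ℝ)) (p : ℝ≥0∞) : MemLp φ p μ :=
  φ.continuous.memLp_of_hasCompactSupport φ.hasCompactSupport

lemma memLp_gradient_testFunction [CompleteSpace E] [IsFiniteMeasureOnCompacts μ] (φ : 𝓓(Ω, ℝ))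
    (p : ℝ≥0∞) : MemLp (∇ (φ : E → ℝ)) p μ :=
  (continuous_gradient (contDiff_one φ)).memLp_of_hasCompactSupport
    (hasCompactSupport_gradient φ.hasCompactSupport)

variable [FiniteDimensional ℝ E] [μ.IsAddHaarMeasure]

lemma eLpNorm_two_fderiv_testFunction (φ : 𝓓(Ω, ℝ)) :
    eLpNorm (fderiv ℝ φ) 2 μ = ENNReal.ofReal √(∫ x, ‖∇ (φ : E → ℝ) x‖ ^ 2 ∂μ) := by
  rw [← eLpNorm_two_eq_ofReal_sqrt_integral (memLp_gradient_testFunction φ 2)]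
  exact eLpNorm_congr_norm_ae (Eventually.of_forall fun x => by
    rw [gradient, LinearIsometryEquiv.norm_map])

lemma exists_subseq_tendsto_integral_testFunction_sub_sq (hE : 2 < Module.finrank ℝ E)
    (hΩ : Bornology.IsBounded (Ω : Set E)) {φ : ℕ → 𝓓(Ω, ℝ)} {B : ℝ}
    (hB : ∀ k, ∫ x, ‖∇ (φ k : E → ℝ) x‖ ^ 2 ∂μ ≤ B) :
    ∃ σ : ℕ → ℕ, StrictMono σ ∧
      Tendsto (fun q : ℕ × ℕ => ∫ x, (φ (σ q.1) x - φ (σ q.2) x) ^ 2 ∂μ) atTop (𝓝 0) := by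
  have hsupp (k : ℕ) : Function.support (φ k) ⊆ Ω :=
    (subset_tsupport _).trans (φ k).tsupport_subset
  have hfderiv (k : ℕ) : eLpNorm (fderiv ℝ (φ k)) 2 μ ≤ ENNReal.ofReal √B := by
    rw [eLpNorm_two_fderiv_testFunction]
    exact ENNReal.ofReal_le_ofReal (Real.sqrt_le_sqrt (hB k))
  obtain ⟨K, hK⟩ : ∃ K : NNReal, ∀ k, eLpNorm (φ k) 2 μ ≤ K * eLpNorm (fderiv ℝ (φ k)) 2 μ :=
    ⟨_, fun k => eLpNorm_le_eLpNorm_fderiv μ (contDiff_one (φ k)) (hsupp k) (p := 2)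
      one_le_two (mod_cast hE) hΩ⟩
  set C : ℝ≥0∞ := ENNReal.ofReal √B
  obtain ⟨σ, hσ, hlim⟩ := exists_subseq_tendsto_eLpNorm_two_sub (C := K * C + C)
    (fun k => contDiff_one (φ k)) hΩ hsupp (by finiteness)
    (fun k => (hK k).trans (le_add_right (by grw [hfderiv k])))
    (fun k => (hfderiv k).trans le_add_self)
  refine ⟨σ, hσ, ?_⟩
  simpa using (tendsto_eLpNorm_two_zero_iff fun q : ℕ × ℕ =>
    (memLp_testFunction (φ (σ q.1)) 2).sub (memLp_testFunction (φ (σ q.2)) 2)).1 hlim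

end TestFunctionRellich

section Closure

variable {N : ℕ} {Ω : Opens (EuclideanSpace ℝ (Fin N))} {W : EuclideanSpace ℝ (Fin N) → ℝ}

lemma integrable_mul_testFunction_sq (hW : LocallyIntegrable W) (φ : 𝓓(Ω, ℝ)) :
    Integrable fun x => W x * φ x ^ 2 :=
  hW.integrable_smul_right_of_hasCompactSupport (φ.continuous.pow 2)
    (hasCompactSupport_sq φ.hasCompactSupport)

lemma setLIntegral_mul_testFunction_sq (hW : LocallyIntegrable W)
    (hW₀ : ∀ᵐ x ∂volume.restrict (Ω : Set (EuclideanSpace ℝ (Fin N))), 0 ≤ W x) (φ : 𝓓(Ω, ℝ)) :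
    ∫⁻ x in Ω, ENNReal.ofReal (W x * φ x ^ 2) = ENNReal.ofReal (∫ x, W x * φ x ^ 2) := by
  rw [← setIntegral_mul_testFunction_sq, ofReal_integral_eq_lintegral_ofReal
    (integrable_mul_testFunction_sq hW φ).integrableOn]
  filter_upwards [hW₀] with x hx using mul_nonneg hx (sq_nonneg _)

lemma setLIntegral_norm_gradient_testFunction_sq (φ : 𝓓(Ω, ℝ)) :
    ∫⁻ x in Ω, ENNReal.ofReal (‖∇ (φ : EuclideanSpace ℝ (Fin N) → ℝ) x‖ ^ 2) =
      ENNReal.ofReal (∫ x, ‖∇ (φ : EuclideanSpace ℝ (Fin N) → ℝ) x‖ ^ 2) := by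
  rw [← setIntegral_norm_gradient_testFunction_sq, lintegral_ofReal_norm_sq,
    eLpNorm_two_sq_eq_ofReal_integral (memLp_gradient_testFunction φ 2)]

lemma memClosure_testFunction (φ : 𝓓(Ω, ℝ)) (p : ℝ≥0∞) :
    MemClosure p Ω φ (∇ (φ : EuclideanSpace ℝ (Fin N) → ℝ)) where
  memLp := memLp_testFunction φ p
  memLp_grad := memLp_gradient_testFunction φ 2
  approx := ⟨fun _ => φ, by simp⟩

variable {p : ℝ≥0∞} {u : EuclideanSpace ℝ (Fin N) → ℝ}
  {g : EuclideanSpace ℝ (Fin N) → EuclideanSpace ℝ (Fin N)}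

lemma MemClosure.lintegral_norm_sq_ne_top (h : MemClosure p Ω u g) :
    ∫⁻ x in Ω, ENNReal.ofReal (‖g x‖ ^ 2) ≠ ∞ := by
  rw [lintegral_ofReal_norm_sq]
  exact ENNReal.pow_ne_top h.memLp_grad.eLpNorm_ne_top

lemma MemClosure.exists_tendsto_ae (h : MemClosure p Ω u g) (hp : p ≠ 0) :
    ∃ φ : ℕ → 𝓓(Ω, ℝ),
      (∀ᵐ x ∂volume.restrict (Ω : Set (EuclideanSpace ℝ (Fin N))),
        Tendsto (fun k => φ k x) atTop (𝓝 (u x))) ∧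
      Tendsto (fun k => ENNReal.ofReal (∫ x, ‖∇ (φ k : EuclideanSpace ℝ (Fin N) → ℝ) x‖ ^ 2)) atTop
        (𝓝 (∫⁻ x in Ω, ENNReal.ofReal (‖g x‖ ^ 2))) := by
  obtain ⟨φ, hφu, hφg⟩ := h.approx
  obtain ⟨σ, hσ, hae⟩ := (tendstoInMeasure_of_tendsto_eLpNorm hp
    (fun k => (φ k).continuous.aestronglyMeasurable) h.memLp.1 hφu).exists_seq_tendsto_ae
  refine ⟨φ ∘ σ, hae, ?_⟩
  simp_rw [← setLIntegral_norm_gradient_testFunction_sq, lintegral_ofReal_norm_sq]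
  exact (ENNReal.Tendsto.pow (tendsto_eLpNorm_of_tendsto_eLpNorm_sub
    (fun k => memLp_gradient_testFunction (φ k) 2) h.memLp_grad hφg)).comp hσ.tendsto_atTop

lemma MemClosure.lintegral_mul_sq_le (h : MemClosure p Ω u g) (hp : p ≠ 0)
    (hW : LocallyIntegrable W)
    (hW₀ : ∀ᵐ x ∂volume.restrict (Ω : Set (EuclideanSpace ℝ (Fin N))), 0 ≤ W x)
    (hWφ : ∀ φ : 𝓓(Ω, ℝ),
      ∫ x, W x * φ x ^ 2 ≤ ∫ x, ‖∇ (φ : EuclideanSpace ℝ (Fin N) → ℝ) x‖ ^ 2) :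
    ∫⁻ x in Ω, ENNReal.ofReal (W x * u x ^ 2) ≤ ∫⁻ x in Ω, ENNReal.ofReal (‖g x‖ ^ 2) := by
  obtain ⟨φ, hφu, hφg⟩ := h.exists_tendsto_ae hp
  refine lintegral_le_of_tendsto_ae (f := fun k x => ENNReal.ofReal (W x * φ k x ^ 2))
    (fun k => ?_) ?_ (fun k => ?_) hφg
  · exact (integrable_mul_testFunction_sq hW (φ k)).aemeasurable.restrict.ennreal_ofReal
  · filter_upwards [hφu] with x hx using ENNReal.tendsto_ofReal ((hx.pow 2).const_mul (W x))
  · rw [setLIntegral_mul_testFunction_sq hW hW₀]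
    exact ENNReal.ofReal_le_ofReal (hWφ (φ k))

lemma MemClosure.ae_eq_zero_of_lt (h : MemClosure p Ω u g) (hp : p ≠ 0)
    {V : EuclideanSpace ℝ (Fin N) → ℝ} (hV : ∀ x, 0 ≤ V x) (hW : LocallyIntegrable W)
    (hVW : ∀ᵐ x ∂volume.restrict (Ω : Set (EuclideanSpace ℝ (Fin N))), V x < W x)
    (hWφ : ∀ φ : 𝓓(Ω, ℝ),
      ∫ x, W x * φ x ^ 2 ≤ ∫ x, ‖∇ (φ : EuclideanSpace ℝ (Fin N) → ℝ) x‖ ^ 2)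
    (hle : ∫⁻ x in Ω, ENNReal.ofReal (‖g x‖ ^ 2) ≤
      ∫⁻ x in Ω, ENNReal.ofReal (V x * u x ^ 2)) :
    u =ᵐ[volume.restrict (Ω : Set (EuclideanSpace ℝ (Fin N)))] 0 := by
  have hWu := h.lintegral_mul_sq_le hp hW (hVW.mono fun x hx => (hV x).trans hx.le) hWφ
  have hVu : (fun x => ENNReal.ofReal (V x * u x ^ 2))
      ≤ᵐ[volume.restrict (Ω : Set (EuclideanSpace ℝ (Fin N)))]
        fun x => ENNReal.ofReal (W x * u x ^ 2) := by
    filter_upwards [hVW] with x hx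
    gcongr
  have heq := ae_eq_of_ae_le_of_lintegral_le hVu
    (((lintegral_mono_ae hVu).trans hWu).trans_lt h.lintegral_norm_sq_ne_top.lt_top).ne
    (hW.aestronglyMeasurable.aemeasurable.restrict.mul
      (h.memLp.1.aemeasurable.pow_const 2)).ennreal_ofReal (hWu.trans hle)
  filter_upwards [heq, hVW] with x hx hlt
  by_contra hux
  have hux2 : 0 < u x ^ 2 := sq_pos_of_ne_zero hux
  exact (ENNReal.ofReal_lt_ofReal_iff_of_nonneg (mul_nonneg (hV x) hux2.le)).2
    (mul_lt_mul_of_pos_right hlt hux2) |>.ne hx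

end Closure

section HardyConstant

variable {N n : ℕ} {Ω : Opens (EuclideanSpace ℝ (Fin N))} {a : Fin n → EuclideanSpace ℝ (Fin N)}

lemma sobolevExponent_ne_zero (hN : 3 ≤ N) : ENNReal.ofReal (2 * N / (N - 2)) ≠ 0 := by
  have hN' : (3 : ℝ) ≤ N := by exact_mod_cast hN
  exact (ENNReal.ofReal_pos.2 (div_pos (by linarith) (by linarith))).ne'

lemma threshold_pos (hN : 3 ≤ N) (hn : 2 ≤ n) : 0 < ((N : ℝ) - 2) ^ 2 / (4 * n - 4) := by
  have hN' : (3 : ℝ) ≤ N := by exact_mod_cast hN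
  have hn' : (2 : ℝ) ≤ n := by exact_mod_cast hn
  exact div_pos (pow_pos (by linarith) 2) (by linarith)

lemma setLIntegral_potential_mul_sq_eq_zero_iff (hN : 3 ≤ N) (hn : 2 ≤ n)
    (ha : Function.Injective a) {u : EuclideanSpace ℝ (Fin N) → ℝ}
    (hu : AEMeasurable u (volume.restrict (Ω : Set (EuclideanSpace ℝ (Fin N))))) :
    ∫⁻ x in Ω, ENNReal.ofReal (potential a x * u x ^ 2) = 0 ↔
      u =ᵐ[volume.restrict (Ω : Set (EuclideanSpace ℝ (Fin N)))] 0 := by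
  have hmeas : AEMeasurable (fun x => ENNReal.ofReal (potential a x * u x ^ 2))
      (volume.restrict (Ω : Set (EuclideanSpace ℝ (Fin N)))) :=
    ((measurable_potential a).aemeasurable.mul (hu.pow_const 2)).ennreal_ofReal
  rw [lintegral_eq_zero_iff' hmeas]
  refine eventually_congr ?_
  filter_upwards [ae_restrict_of_ae (ae_forall_ne hN a)] with x hx
  have hVx := potential_pos hn ha hx
  rw [Pi.zero_apply, Pi.zero_apply, ENNReal.ofReal_eq_zero, ← not_lt, mul_pos_iff_of_pos_left hVx,
    not_lt, sq_nonpos_iff]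

lemma setLIntegral_potential_mul_testFunction_sq (hN : 3 ≤ N)
    (a : Fin n → EuclideanSpace ℝ (Fin N)) (φ : 𝓓(Ω, ℝ)) :
    ∫⁻ x in Ω, ENNReal.ofReal (potential a x * φ x ^ 2) =
      ENNReal.ofReal (∫ x, potential a x * φ x ^ 2) :=
  setLIntegral_mul_testFunction_sq (locallyIntegrable_potential hN a)
    (Eventually.of_forall (potential_nonneg a)) φ

lemma ofReal_le_hardyConstant_iff (hN : 3 ≤ N) (hn : 2 ≤ n) (ha : Function.Injective a) {q : ℝ}
    (hq : 0 ≤ q) :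
    ENNReal.ofReal q ≤ hardyConstant a Ω ↔ ∀ φ : 𝓓(Ω, ℝ),
      q * ∫ x, potential a x * φ x ^ 2 ≤ ∫ x, ‖∇ (φ : EuclideanSpace ℝ (Fin N) → ℝ) x‖ ^ 2 := by
  refine ⟨fun h φ => ?_, fun h => le_sInf ?_⟩
  · have hG : 0 ≤ ∫ x, ‖∇ (φ : EuclideanSpace ℝ (Fin N) → ℝ) x‖ ^ 2 :=
      integral_nonneg fun x => sq_nonneg _
    rcases le_or_gt (∫ x, potential a x * φ x ^ 2) 0 with hP | hP
    · exact (mul_nonpos_of_nonneg_of_nonpos hq hP).trans hG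
    have hφ : ¬ φ =ᵐ[volume.restrict (Ω : Set (EuclideanSpace ℝ (Fin N)))] 0 := by
      rw [← setLIntegral_potential_mul_sq_eq_zero_iff hN hn ha φ.continuous.aemeasurable,
        setLIntegral_potential_mul_testFunction_sq hN]
      exact (ENNReal.ofReal_pos.2 hP).ne'
    have hle := h.trans (sInf_le ⟨φ, _, memClosure_testFunction φ _, hφ, rfl⟩)
    rw [hardyQuotient, setLIntegral_potential_mul_testFunction_sq hN,
      setLIntegral_norm_gradient_testFunction_sq, ← ENNReal.ofReal_div_of_pos hP,
      ENNReal.ofReal_le_ofReal_iff (div_nonneg hG hP.le)] at hle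
    exact (le_div_iff₀ hP).1 hle
  · rintro _ ⟨u, g, hug, hu, rfl⟩
    have hVu := mt (setLIntegral_potential_mul_sq_eq_zero_iff hN hn ha
      hug.memLp.1.aemeasurable).1 hu
    rw [hardyQuotient, ENNReal.le_div_iff_mul_le (.inl hVu) (.inr hug.lintegral_norm_sq_ne_top)]
    calc ENNReal.ofReal q * ∫⁻ x in Ω, ENNReal.ofReal (potential a x * u x ^ 2)
        = ∫⁻ x in Ω, ENNReal.ofReal (q * potential a x * u x ^ 2) := by
          simp_rw [mul_assoc q, ENNReal.ofReal_mul hq]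
          rw [lintegral_const_mul' _ _ ENNReal.ofReal_ne_top]
      _ ≤ ∫⁻ x in Ω, ENNReal.ofReal (‖g x‖ ^ 2) := by
          refine hug.lintegral_mul_sq_le (sobolevExponent_ne_zero hN)
            ((locallyIntegrable_potential hN a).smul q)
            (Eventually.of_forall fun x => mul_nonneg hq (potential_nonneg a x)) fun φ => ?_
          simpa only [Pi.smul_apply, smul_eq_mul, mul_assoc, integral_const_mul] using h φ

lemma hardyConstant_le_threshold (hN : 3 ≤ N) (hn : 2 ≤ n) (ha : Function.Injective a)
    (haΩ : ∀ i, a i ∈ Ω) :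
    hardyConstant a Ω ≤ ENNReal.ofReal (((N : ℝ) - 2) ^ 2 / (4 * n - 4)) := by
  by_contra! hlt
  obtain ⟨μ, hμ₀, hμ, hμlt⟩ := ENNReal.lt_iff_exists_real_btwn.1 hlt
  obtain ⟨φ, hφ⟩ := exists_testFunction_lt_mul_potential hN hn ha haΩ
    (ENNReal.ofReal_lt_ofReal_iff'.1 hμ).1 0
  have hle := (ofReal_le_hardyConstant_iff hN hn ha hμ₀).1 hμlt.le φ
  linarith

theorem not_attained_of_two_poles (hN : 3 ≤ N)
    (hΩ : Bornology.IsBounded (Ω : Set (EuclideanSpace ℝ (Fin N))))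
    {a : Fin 2 → EuclideanSpace ℝ (Fin N)} (ha : Function.Injective a) (haΩ : ∀ i, a i ∈ Ω)
    {u : EuclideanSpace ℝ (Fin N) → ℝ} {g : EuclideanSpace ℝ (Fin N) → EuclideanSpace ℝ (Fin N)}
    (hug : MemD12 Ω u g) (hq : hardyQuotient a Ω u g = hardyConstant a Ω) :
    u =ᵐ[volume.restrict (Ω : Set (EuclideanSpace ℝ (Fin N)))] 0 := by
  obtain ⟨W, hW, hVW, hWφ⟩ := exists_two_pole_hardy_weight hN a hΩ
  refine hug.ae_eq_zero_of_lt (sobolevExponent_ne_zero hN)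
    (fun x => mul_nonneg (by positivity) (potential_nonneg a x)) hW
    ((ae_restrict_iff' Ω.isOpen.measurableSet).2 hVW)
    (fun φ => hWφ φ (contDiff_one φ) φ.hasCompactSupport) ?_
  have hle := hq.trans_le (hardyConstant_le_threshold hN le_rfl ha haΩ)
  have hthr : ((N : ℝ) - 2) ^ 2 / (4 * (2 : ℕ) - 4) = ((N : ℝ) - 2) ^ 2 / 4 := by norm_num
  have hpos : 0 < ((N : ℝ) - 2) ^ 2 / 4 := hthr ▸ threshold_pos hN le_rfl
  rw [hthr, hardyQuotient, ENNReal.div_le_iff_le_mul (.inr ENNReal.ofReal_ne_top)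
    (.inr (ENNReal.ofReal_pos.2 hpos).ne')] at hle
  simp_rw [mul_assoc (((N : ℝ) - 2) ^ 2 / 4), ENNReal.ofReal_mul hpos.le]
  rwa [lintegral_const_mul' _ _ ENNReal.ofReal_ne_top]

end HardyConstant

section QuadraticForm

variable {N : ℕ} {Ω : Opens (EuclideanSpace ℝ (Fin N))} {W : EuclideanSpace ℝ (Fin N) → ℝ}

lemma integral_gradient_testFunction_sq_parallelogram (φ ψ : 𝓓(Ω, ℝ)) :
    (∫ x, ‖∇ ((φ + ψ : 𝓓(Ω, ℝ)) : EuclideanSpace ℝ (Fin N) → ℝ) x‖ ^ 2) +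
        ∫ x, ‖∇ ((φ - ψ : 𝓓(Ω, ℝ)) : EuclideanSpace ℝ (Fin N) → ℝ) x‖ ^ 2 =
      2 * (∫ x, ‖∇ (φ : EuclideanSpace ℝ (Fin N) → ℝ) x‖ ^ 2) +
        2 * ∫ x, ‖∇ (ψ : EuclideanSpace ℝ (Fin N) → ℝ) x‖ ^ 2 := by
  simp_rw [gradient_testFunction_add, gradient_testFunction_sub]
  exact integral_norm_sq_parallelogram (memLp_gradient_testFunction φ 2)
    (memLp_gradient_testFunction ψ 2)

lemma integral_mul_testFunction_sq_parallelogram (hW : LocallyIntegrable W) (φ ψ : 𝓓(Ω, ℝ)) :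
    (∫ x, W x * (φ + ψ) x ^ 2) + ∫ x, W x * (φ - ψ) x ^ 2 =
      2 * (∫ x, W x * φ x ^ 2) + 2 * ∫ x, W x * ψ x ^ 2 := by
  rw [← integral_add (integrable_mul_testFunction_sq hW _) (integrable_mul_testFunction_sq hW _),
    ← integral_const_mul, ← integral_const_mul,
    ← integral_add ((integrable_mul_testFunction_sq hW φ).const_mul 2)
      ((integrable_mul_testFunction_sq hW ψ).const_mul 2)]
  refine integral_congr_ae (Eventually.of_forall fun x => ?_)
  change W x * (φ x + ψ x) ^ 2 + W x * (φ x - ψ x) ^ 2 = _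
  ring

/-- The quadratic form `∫ |∇φ|² - m ∫ W φ²` of the Schrödinger operator `-Δ - m W`. For the optimal
`m` it is nonnegative, and it tends to `0` along a normalized minimizing sequence. -/
def schrodingerForm (W : EuclideanSpace ℝ (Fin N) → ℝ) (m : ℝ) (φ : 𝓓(Ω, ℝ)) : ℝ :=
  (∫ x, ‖∇ (φ : EuclideanSpace ℝ (Fin N) → ℝ) x‖ ^ 2) - m * ∫ x, W x * φ x ^ 2

lemma schrodingerForm_parallelogram (hW : LocallyIntegrable W) (m : ℝ) (φ ψ : 𝓓(Ω, ℝ)) :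
    schrodingerForm W m (φ + ψ) + schrodingerForm W m (φ - ψ) =
      2 * schrodingerForm W m φ + 2 * schrodingerForm W m ψ := by
  unfold schrodingerForm
  linear_combination integral_gradient_testFunction_sq_parallelogram φ ψ -
    m * integral_mul_testFunction_sq_parallelogram hW φ ψ

lemma tendsto_schrodingerForm_sub (hW : LocallyIntegrable W) {m : ℝ}
    (hm : ∀ φ : 𝓓(Ω, ℝ), 0 ≤ schrodingerForm W m φ) {χ : ℕ → 𝓓(Ω, ℝ)}
    (hχ : Tendsto (fun k => schrodingerForm W m (χ k)) atTop (𝓝 0)) :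
    Tendsto (fun q : ℕ × ℕ => schrodingerForm W m (χ q.1 - χ q.2)) atTop (𝓝 0) := by
  rw [← prod_atTop_atTop_eq]
  have hsum := ((hχ.comp tendsto_fst).const_mul 2).add ((hχ.comp tendsto_snd).const_mul 2)
  rw [mul_zero, add_zero] at hsum
  refine squeeze_zero (fun q => hm _) (fun q => ?_) hsum
  dsimp only [Function.comp_apply]
  linarith [schrodingerForm_parallelogram hW m (χ q.1) (χ q.2), hm (χ q.1 + χ q.2)]

lemma tendsto_integral_of_tendsto_schrodingerForm {ι : Type*} {l : Filter ι} {φ : ι → 𝓓(Ω, ℝ)}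
    {m μ c : ℝ} (hmμ : m < μ) (hW₀ : ∀ x, 0 ≤ W x)
    (hμ : ∀ φ : 𝓓(Ω, ℝ), μ * ∫ x, W x * φ x ^ 2 ≤
      c * (∫ x, φ x ^ 2) + ∫ x, ‖∇ (φ : EuclideanSpace ℝ (Fin N) → ℝ) x‖ ^ 2)
    (hS : Tendsto (fun i => ∫ x, φ i x ^ 2) l (𝓝 0))
    (hD : Tendsto (fun i => schrodingerForm W m (φ i)) l (𝓝 0)) :
    Tendsto (fun i => ∫ x, W x * φ i x ^ 2) l (𝓝 0) ∧
      Tendsto (fun i => ∫ x, ‖∇ (φ i : EuclideanSpace ℝ (Fin N) → ℝ) x‖ ^ 2) l (𝓝 0) := by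
  unfold schrodingerForm at hD
  have hP : Tendsto (fun i => ∫ x, W x * φ i x ^ 2) l (𝓝 0) := by
    have hbound := ((hS.const_mul c).add hD).div_const (μ - m)
    rw [mul_zero, add_zero, zero_div] at hbound
    refine squeeze_zero (fun i => integral_nonneg fun x => mul_nonneg (hW₀ x) (sq_nonneg _))
      (fun i => ?_) hbound
    rw [le_div_iff₀ (sub_pos.2 hmμ)]
    linarith [hμ (φ i)]
  refine ⟨hP, ?_⟩
  simpa using hD.add (hP.const_mul m)

lemma memLp_sqrt_mul_testFunction (hW : LocallyIntegrable W) (hW₀ : ∀ x, 0 ≤ W x) (φ : 𝓓(Ω, ℝ)) :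
    MemLp (fun x => √(W x) * φ x) 2 := by
  refine (memLp_two_iff_integrable_sq
    ((Real.continuous_sqrt.comp_aestronglyMeasurable hW.aestronglyMeasurable).mul
      φ.continuous.aestronglyMeasurable)).2 ?_
  simpa only [Pi.mul_apply, mul_pow, Function.comp_apply, Real.sq_sqrt (hW₀ _)] using
    integrable_mul_testFunction_sq hW φ

lemma exists_memH10_of_tendsto (hW : LocallyIntegrable W) (hW₀ : ∀ x, 0 ≤ W x)
    {χ : ℕ → 𝓓(Ω, ℝ)} {m p : ℝ}
    (hS : Tendsto (fun q : ℕ × ℕ => ∫ x, (χ q.1 - χ q.2) x ^ 2) atTop (𝓝 0))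
    (hP : Tendsto (fun q : ℕ × ℕ => ∫ x, W x * (χ q.1 - χ q.2) x ^ 2) atTop (𝓝 0))
    (hG : Tendsto (fun q : ℕ × ℕ =>
      ∫ x, ‖∇ ((χ q.1 - χ q.2 : 𝓓(Ω, ℝ)) : EuclideanSpace ℝ (Fin N) → ℝ) x‖ ^ 2) atTop (𝓝 0))
    (hp : Tendsto (fun k => ∫ x, W x * χ k x ^ 2) atTop (𝓝 p))
    (hm : Tendsto (fun k => ∫ x, ‖∇ (χ k : EuclideanSpace ℝ (Fin N) → ℝ) x‖ ^ 2) atTop (𝓝 m)) :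
    ∃ u g, MemH10 Ω u g ∧ ∫⁻ x in Ω, ENNReal.ofReal (W x * u x ^ 2) = ENNReal.ofReal p ∧
      ∫⁻ x in Ω, ENNReal.ofReal (‖g x‖ ^ 2) = ENNReal.ofReal m := by
  simp_rw [← setIntegral_testFunction_sq (μ := volume) (Ω := Ω)] at hS
  simp_rw [← setIntegral_mul_testFunction_sq (μ := volume) (Ω := Ω)] at hP hp
  simp_rw [← setIntegral_norm_gradient_testFunction_sq (μ := volume) (Ω := Ω)] at hG hm
  have hsq (x : EuclideanSpace ℝ (Fin N)) (t : ℝ) : ‖√(W x) * t‖ ^ 2 = W x * t ^ 2 := by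
    rw [norm_mul, mul_pow, Real.norm_eq_abs, Real.norm_eq_abs, sq_abs, sq_abs,
      Real.sq_sqrt (hW₀ x)]
  obtain ⟨u, hu, hulim⟩ := exists_tendsto_eLpNorm_sub (p := 2) (f := fun k => χ k)
    (fun k => memLp_testFunction (χ k) 2) ((tendsto_eLpNorm_two_zero_iff fun q : ℕ × ℕ =>
      (memLp_testFunction (χ q.1) 2).sub (memLp_testFunction (χ q.2) 2)).2 (by simpa using hS))
  obtain ⟨g, hg, hglim, hgm⟩ := exists_tendsto_eLpNorm_two_sub
    (fun k => memLp_gradient_testFunction (χ k) 2)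
    (by simpa only [gradient_testFunction_sub] using hG) hm
  obtain ⟨w, hw, hwlim, hwp⟩ := exists_tendsto_eLpNorm_two_sub
    (μ := volume.restrict Ω) (f := fun k x => √(W x) * χ k x)
    (fun k => (memLp_sqrt_mul_testFunction hW hW₀ (χ k)).restrict Ω)
    (by simp_rw [← mul_sub, hsq]; exact hP) (by simp_rw [hsq]; exact hp)
  have hwu : w =ᵐ[volume.restrict Ω] (fun x => √(W x)) * u :=
    ae_eq_mul_of_tendsto_eLpNorm two_ne_zero two_ne_zero (fun k => (memLp_testFunction (χ k) 2).1)
      (Real.continuous_sqrt.comp_aestronglyMeasurable hW.aestronglyMeasurable).restrict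
      hu.1 hw.1 hulim hwlim
  refine ⟨u, g, ⟨hu, hg, χ, hulim, hglim⟩, ?_, hgm⟩
  rw [← hwp]
  refine lintegral_congr_ae ?_
  filter_upwards [hwu] with x hx
  rw [hx, Pi.mul_apply, hsq]

end QuadraticForm

section Minimizer

variable {N n : ℕ} {Ω : Opens (EuclideanSpace ℝ (Fin N))} {a : Fin n → EuclideanSpace ℝ (Fin N)}

lemma exists_testFunction_integral_eq_one {W : EuclideanSpace ℝ (Fin N) → ℝ} {φ : 𝓓(Ω, ℝ)} {q : ℝ}
    (hP : 0 < ∫ x, W x * φ x ^ 2)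
    (hφ : ∫ x, ‖∇ (φ : EuclideanSpace ℝ (Fin N) → ℝ) x‖ ^ 2 < q * ∫ x, W x * φ x ^ 2) :
    ∃ ψ : 𝓓(Ω, ℝ), ∫ x, W x * ψ x ^ 2 = 1 ∧
      ∫ x, ‖∇ (ψ : EuclideanSpace ℝ (Fin N) → ℝ) x‖ ^ 2 < q := by
  set P := ∫ x, W x * φ x ^ 2 with hPdef
  have hs : (√P)⁻¹ ^ 2 = P⁻¹ := by rw [inv_pow, Real.sq_sqrt hP.le]
  refine ⟨(√P)⁻¹ • φ, ?_, ?_⟩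
  · have hsmul (x : EuclideanSpace ℝ (Fin N)) :
        W x * ((√P)⁻¹ • φ) x ^ 2 = P⁻¹ * (W x * φ x ^ 2) := by
      change W x * ((√P)⁻¹ * φ x) ^ 2 = _
      rw [mul_pow, hs, mul_left_comm]
    simp_rw [hsmul]
    rw [integral_const_mul, ← hPdef, inv_mul_cancel₀ hP.ne']
  · simp_rw [gradient_testFunction_smul, norm_smul, mul_pow, Real.norm_eq_abs, sq_abs, hs]
    rwa [integral_const_mul, inv_mul_lt_iff₀ hP, mul_comm P]

lemma exists_minimizing_seq (hN : 3 ≤ N) (hn : 2 ≤ n) (ha : Function.Injective a)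
    (hfin : hardyConstant a Ω ≠ ∞) :
    ∃ χ : ℕ → 𝓓(Ω, ℝ), (∀ k, ∫ x, potential a x * χ k x ^ 2 = 1) ∧
      Tendsto (fun k => ∫ x, ‖∇ (χ k : EuclideanSpace ℝ (Fin N) → ℝ) x‖ ^ 2) atTop
        (𝓝 (hardyConstant a Ω).toReal) := by
  set m := (hardyConstant a Ω).toReal
  have hm : 0 ≤ m := ENNReal.toReal_nonneg
  have hle := (ofReal_le_hardyConstant_iff hN hn ha hm).1 (ENNReal.ofReal_toReal hfin).le
  have hexists (k : ℕ) : ∃ ψ : 𝓓(Ω, ℝ), ∫ x, potential a x * ψ x ^ 2 = 1 ∧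
      ∫ x, ‖∇ (ψ : EuclideanSpace ℝ (Fin N) → ℝ) x‖ ^ 2 < m + 1 / ((k : ℝ) + 1) := by
    have hk : 0 < 1 / ((k : ℝ) + 1) := Nat.one_div_pos_of_nat
    have hlt : hardyConstant a Ω < ENNReal.ofReal (m + 1 / ((k : ℝ) + 1)) :=
      (ENNReal.lt_ofReal_iff_toReal_lt hfin).2 (lt_add_of_pos_right m hk)
    have hnot := mt (ofReal_le_hardyConstant_iff hN hn ha (by positivity)).2 hlt.not_ge
    push Not at hnot
    obtain ⟨φ, hφ⟩ := hnot
    refine exists_testFunction_integral_eq_one ?_ hφ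
    exact pos_of_mul_pos_right ((integral_nonneg fun x => sq_nonneg _).trans_lt hφ) (by positivity)
  choose χ hP hG using hexists
  refine ⟨χ, hP, tendsto_of_tendsto_of_tendsto_of_le_of_le tendsto_const_nhds
    (by simpa using tendsto_one_div_add_atTop_nhds_zero_nat.const_add m) (fun k => ?_)
    fun k => (hG k).le⟩
  simpa only [hP, mul_one] using hle (χ k)

theorem exists_minimizer (hN : 3 ≤ N) (hn : 2 ≤ n)
    (hΩ : Bornology.IsBounded (Ω : Set (EuclideanSpace ℝ (Fin N)))) (ha : Function.Injective a)
    (hlt : hardyConstant a Ω < ENNReal.ofReal (((N : ℝ) - 2) ^ 2 / (4 * n - 4))) :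
    ∃ u g, MemH10 Ω u g ∧ ¬ u =ᵐ[volume.restrict (Ω : Set (EuclideanSpace ℝ (Fin N)))] 0 ∧
      hardyQuotient a Ω u g = hardyConstant a Ω := by
  have hfin := hlt.ne_top
  have hm := (ofReal_le_hardyConstant_iff (Ω := Ω) hN hn ha ENNReal.toReal_nonneg).1
    (ENNReal.ofReal_toReal hfin).le
  obtain ⟨μ, hmμ, hμ⟩ := exists_between ((ENNReal.lt_ofReal_iff_toReal_lt hfin).1 hlt)
  obtain ⟨c, hc⟩ := exists_mul_integral_potential_mul_sq_le hN hn ha hμ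
  obtain ⟨χ, hP, hG⟩ := exists_minimizing_seq hN hn ha hfin
  obtain ⟨B, hB⟩ := hG.bddAbove_range
  obtain ⟨σ, hσ, hS⟩ := exists_subseq_tendsto_integral_testFunction_sub_sq
    (two_lt_finrank_euclideanSpace hN) hΩ fun k => hB (Set.mem_range_self k)
  have hGσ := hG.comp hσ.tendsto_atTop
  have hW := locallyIntegrable_potential hN a
  have hform := tendsto_schrodingerForm_sub hW (fun φ => sub_nonneg.2 (hm φ)) (χ := χ ∘ σ)
    (by simpa [schrodingerForm, hP] using hGσ.sub_const (hardyConstant a Ω).toReal)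
  obtain ⟨hPsub, hGsub⟩ := tendsto_integral_of_tendsto_schrodingerForm hmμ (potential_nonneg a)
    (fun φ => hc φ (contDiff_one φ) φ.hasCompactSupport)
    (φ := fun q : ℕ × ℕ => χ (σ q.1) - χ (σ q.2)) hS hform
  obtain ⟨u, g, hug, hVu, hg⟩ := exists_memH10_of_tendsto hW (potential_nonneg a) (χ := χ ∘ σ)
    hS hPsub hGsub (p := 1) (by simp [hP]) hGσ
  rw [ENNReal.ofReal_one] at hVu
  rw [ENNReal.ofReal_toReal hfin] at hg
  refine ⟨u, g, hug, ?_, by rw [hardyQuotient, hVu, hg, div_one]⟩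
  rw [← setLIntegral_potential_mul_sq_eq_zero_iff hN hn ha hug.memLp.1.aemeasurable, hVu]
  exact one_ne_zero

end Minimizer

section WeakHardyConstant

variable {N n : ℕ} {a : Fin n → EuclideanSpace ℝ (Fin N)}

lemma exists_mul_setIntegral_potential_le (hN : 3 ≤ N) (hn : 2 ≤ n) (ha : Function.Injective a)
    (Ω : Opens (EuclideanSpace ℝ (Fin N))) {μ : ℝ} (hμ : μ < ((N : ℝ) - 2) ^ 2 / (4 * n - 4)) :
    ∃ c : ℝ, ∀ u : 𝓓(Ω, ℝ), μ * ∫ x in Ω, potential a x * u x ^ 2 ≤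
      c * (∫ x in Ω, u x ^ 2) + ∫ x in Ω, ‖∇ (u : EuclideanSpace ℝ (Fin N) → ℝ) x‖ ^ 2 := by
  simp_rw [setIntegral_testFunction_sq, setIntegral_norm_gradient_testFunction_sq,
    setIntegral_mul_testFunction_sq]
  obtain ⟨c, hc⟩ := exists_mul_integral_potential_mul_sq_le hN hn ha hμ
  exact ⟨c, fun u => hc u (contDiff_one u) u.hasCompactSupport⟩

lemma exists_lt_mul_setIntegral_potential (hN : 3 ≤ N) (hn : 2 ≤ n) (ha : Function.Injective a)
    {Ω : Opens (EuclideanSpace ℝ (Fin N))} (haΩ : ∀ i, a i ∈ Ω) {μ : ℝ}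
    (hμ : ((N : ℝ) - 2) ^ 2 / (4 * n - 4) < μ) (c : ℝ) : ∃ u : 𝓓(Ω, ℝ),
      c * (∫ x in Ω, u x ^ 2) + (∫ x in Ω, ‖∇ (u : EuclideanSpace ℝ (Fin N) → ℝ) x‖ ^ 2) <
        μ * ∫ x in Ω, potential a x * u x ^ 2 := by
  simp_rw [setIntegral_testFunction_sq, setIntegral_norm_gradient_testFunction_sq,
    setIntegral_mul_testFunction_sq]
  exact exists_testFunction_lt_mul_potential hN hn ha haΩ hμ c

theorem isLUB_weakHardyParameters (hN : 3 ≤ N) (hn : 2 ≤ n) (ha : Function.Injective a)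
    {Ω : Opens (EuclideanSpace ℝ (Fin N))} (haΩ : ∀ i, a i ∈ Ω) :
    IsLUB (weakHardyParameters a Ω) (((N : ℝ) - 2) ^ 2 / (4 * n - 4)) := by
  have hmem {μ : ℝ} (hμ₀ : 0 < μ) (hμ : μ < ((N : ℝ) - 2) ^ 2 / (4 * n - 4)) :
      μ ∈ weakHardyParameters a Ω := by
    obtain ⟨c, hc⟩ := exists_mul_setIntegral_potential_le hN hn ha Ω hμ
    exact ⟨hμ₀, -c, fun u => by linarith [hc u]⟩
  refine ⟨?_, fun b hb =>
    (isLUB_Ioo (threshold_pos hN hn)).2 fun μ hμ => hb (hmem hμ.1 hμ.2)⟩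
  rintro μ ⟨-, c, hc⟩
  by_contra! hlt
  obtain ⟨u, hu⟩ := exists_lt_mul_setIntegral_potential hN hn ha haΩ hlt (-c)
  linarith [hc u]

end WeakHardyConstant

end

end MultipolarHardy

theorem theorem2 {N n : ℕ} (hN : 3 ≤ N) (hn : 2 ≤ n)
    (Ω : Opens (EuclideanSpace ℝ (Fin N)))
    (hΩ : Bornology.IsBounded (Ω : Set (EuclideanSpace ℝ (Fin N))))
    (a : Fin n → EuclideanSpace ℝ (Fin N)) (ha : Function.Injective a) (haΩ : ∀ i, a i ∈ Ω) :
    -- the potential term is finite on `C_0^∞(Ω)`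
    (∀ u : 𝓓(Ω, ℝ), IntegrableOn (fun x => MultipolarHardy.potential a x * u x ^ 2) Ω) ∧
    -- below the threshold
    (∀ μ : ℝ, μ < ((N : ℝ) - 2) ^ 2 / (4 * n - 4) → ∃ c : ℝ, ∀ u : 𝓓(Ω, ℝ),
      c * (∫ x in Ω, u x ^ 2) + (∫ x in Ω, ‖∇ (u : EuclideanSpace ℝ (Fin N) → ℝ) x‖ ^ 2) ≥
        μ * ∫ x in Ω, MultipolarHardy.potential a x * u x ^ 2) ∧
    -- above the threshold
    (∀ μ : ℝ, ((N : ℝ) - 2) ^ 2 / (4 * n - 4) < μ → ∀ c : ℝ, ∃ u : 𝓓(Ω, ℝ),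
      c * (∫ x in Ω, u x ^ 2) + (∫ x in Ω, ‖∇ (u : EuclideanSpace ℝ (Fin N) → ℝ) x‖ ^ 2) <
        μ * ∫ x in Ω, MultipolarHardy.potential a x * u x ^ 2) ∧
    -- the weak Hardy constant
    IsLUB (MultipolarHardy.weakHardyParameters a Ω) (((N : ℝ) - 2) ^ 2 / (4 * n - 4)) ∧
    -- attainment in `H¹₀(Ω)` below the threshold
    (MultipolarHardy.hardyConstant a Ω < ENNReal.ofReal (((N : ℝ) - 2) ^ 2 / (4 * n - 4)) →
      ∃ u g, MultipolarHardy.MemH10 Ω u g ∧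
        ¬ u =ᵐ[volume.restrict (Ω : Set (EuclideanSpace ℝ (Fin N)))] 0 ∧
        MultipolarHardy.hardyQuotient a Ω u g = MultipolarHardy.hardyConstant a Ω) ∧
    -- no attainment in `D^{1,2}(Ω)` for two poles
    (n = 2 → ¬ ∃ u g, MultipolarHardy.MemD12 Ω u g ∧
      ¬ u =ᵐ[volume.restrict (Ω : Set (EuclideanSpace ℝ (Fin N)))] 0 ∧
      MultipolarHardy.hardyQuotient a Ω u g = MultipolarHardy.hardyConstant a Ω) := by
  open MultipolarHardy in
  refine ⟨fun u =>
      (integrable_mul_testFunction_sq (locallyIntegrable_potential hN a) u).integrableOn,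
    fun μ hμ => exists_mul_setIntegral_potential_le hN hn ha Ω hμ,
    fun μ hμ => exists_lt_mul_setIntegral_potential hN hn ha haΩ hμ,
    isLUB_weakHardyParameters hN hn ha haΩ, exists_minimizer hN hn hΩ ha, ?_⟩
  rintro rfl ⟨u, g, hug, hu, hq⟩
  exact hu (MultipolarHardy.not_attained_of_two_poles hN hΩ ha haΩ hug hq)
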